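/- **Setting.** Consider $N$ agents joined by an undirected graph and partitioned into $G$ groups $\mathcal G_1,\dots,\mathcal G_G$, each nonempty and inducing a connected subgraph. Agent $k$ has neighborhood $\mathcal N_k\ni k$, a cost $J_k:\mathbb R^M\to\mathbb R$ minimized at $w_k^o$, and $w_k^o=w_\ell^o$ whenever $k,\ell$ are in the same group (each group lies in one cluster, a cluster being a set of all agents with a common minimizer). For $k\in\mathcal G_m$, the combination coefficients satisfy $a_{\ell k}>0$ if $\ell\in\mathcal N_k\cap\mathcal G_m$, $a_{\ell k}=0$ otherwise, and $\sum_\ell a_{\ell k}=1$; put $A=[a_{\ell k}]$. Let $p\in\mathbb R^N$ be the vector with $Ap=p$ and $\sum_{k\in\mathcal G_m}p_k=1$ for every $m$. Norms are Euclidean norms of vectors and induced 2-norms of matrices. **Costs.** Each $J_k$ is strictly convex and twice differentiable with $\lambda_{k,L}I\le\nabla^2J_k(w)\le\lambda_{k,U}I$ for all $w$, where $0\le\lambda_{k,L}\le\lambda_{k,U}<\infty$; each group contains an agent with $\lambda_{k,L}>0$; and $\mathcal W=\mathrm{col}\{w_k\}\mapsto\mathrm{diag}\{\nabla^2J_k(w_k)\}$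 is Lipschitz on $\mathbb R^{NM}$. **Noise.** Let $(\mathbb F_i)$ be a filtration on a probability space, and let $\widehat{\nabla J_k}$ at time $i$ be random approximations of $\nabla J_k$ (not depending on the step-sizes). Let $\mathcal S_i(\mathcal W)=\mathrm{col}\{\widehat{\nabla J_k}(w_k)-\nabla J_k(w_k)\}$ and $\mathcal W^o=\mathrm{col}\{w_k^o\}$. For every $i$ and every $\mathbb F_{i-1}$-measurable random $\mathcal W$ with $\mathbb E\|\mathcal W\|^4<\infty$, put $\mathcal R_{s,i}(\mathcal W)=\mathbb E[\mathcal S_i(\mathcal W)\mathcal S_i(\mathcal W)^{\mathsf T}\mid\mathbb F_{i-1}]$ and assume that $\mathcal S_i(\mathcal W)$ is $\mathbb F_i$-measurable and, almost surely, $$\mathbb E[\mathcal S_i(\mathcal W)\mid\mathbb F_{i-1}]=0,\qquad \mathbb E[\|\mathcal S_i(\mathcal W)\|^4\mid\mathbb F_{i-1}]\le\alpha^2\|\mathcal W^o-\mathcal W\|^4+\sigma_s^4,$$ $$\|\mathcal R_{s,i}(\mathcal W^o)-\mathcal R_{s,i}(\mathcal W)\|\le\kappa_s\|\mathcal W^o-\mathcal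 W\|^{\gamma_s},\qquad \mathcal R_{s,i}(\mathcal W^o)\to\mathcal R_s\ \ (i\to\infty),$$ with constants $\alpha,\sigma_s,\kappa_s\ge0$, $0<\gamma_s\le4$, and a symmetric positive definite deterministic matrix $\mathcal R_s$. **Recursions.** For step-sizes $\mu_k>0$ with $\mu_{\max}=\max_k\mu_k$, the diffusion iterates are, for $k\in\mathcal G_m$, $$\psi_{k,i}=w_{k,i-1}-\mu_k\widehat{\nabla J_k}(w_{k,i-1}),\qquad w_{k,i}=\sum_{\ell\in\mathcal N_k\cap\mathcal G_m}a_{\ell k}\psi_{\ell,i},\qquad \mathcal W_i=\mathrm{col}\{w_{k,i}\}.$$ With $\mathcal M=\mathrm{diag}\{\mu_k\}\otimes I_M$, $\mathcal P=\mathrm{diag}\{p_1^g,\dots,p_G^g\}\otimes I_M\in\mathbb R^{NM\times GM}$ (where $p_m^g$ is the block of $p$ on $\mathcal G_m$), $D_m=I_M-\sum_{k\in\mathcal G_m}p_k\mu_k\nabla^2J_k(w_k^o)$ and $\mathcal D=\mathrm{diag}\{D_1,\dots,D_G\}$, the centroid error is $$\widetilde{\mathcal W}_i^{\rm low}=\mathcal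 D\,\widetilde{\mathcal W}_{i-1}^{\rm low}+\mathcal P^{\mathsf T}\mathcal M\,\mathcal S_i(\mathcal W_{i-1}).$$ The initial network vector and the initial centroid error are arbitrary random vectors, measurable with respect to the initial $\sigma$-field, with finite fourth and finite second moment respectively. **Lemma.** For every $\tau>0$ there are $\mu_0>0$ and $C\ge0$ such that, for all step-sizes with $\mu_{\max}\le\mu_0$ and $\mu_k\ge\tau\mu_{\max}>0$ for all $k$, the discrete Lyapunov equation $$\Theta=\mathcal D\Theta\mathcal D+\mathcal P^{\mathsf T}\mathcal M\mathcal R_s\mathcal M\mathcal P$$ has a unique solution $\Theta\in\mathbb R^{GM\times GM}$, it is symmetric and positive definite, and, for all initial conditions as above, $\mathbb E\|\widetilde{\mathcal W}_i^{\rm low}\|^2<\infty$ for every $i$ and $$\limsup_{i\to\infty}\big\|\mathbb E[\widetilde{\mathcal W}_i^{\rm low}(\widetilde{\mathcal W}_i^{\rm low})^{\mathsf T}]-\Theta\big\|\le C\,\mu_{\max}^{1+\gamma_s/2}.$$ -/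

import Mathlib

open Filter Topology MeasureTheory
open scoped Matrix Kronecker Matrix.Norms.L2Operator

noncomputable section

namespace DiffusionNet

/-- Local parameter vectors, with the Euclidean norm. -/
abbrev Vec (M : ℕ) := EuclideanSpace ℝ (Fin M)

/-- Network vectors `col{w_1, …, w_N}`, with the Euclidean norm of `ℝ^{NM}`. -/
abbrev NetVec (N M : ℕ) := PiLp 2 (fun _ : Fin N => Vec M)

/-- A network of `N` agents with `G` groups; every group is nonempty and connected in the
underlying topology. -/
structure Network (N G : ℕ) where
  topology : SimpleGraph (Fin N)
  group : Fin N → Fin G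
  group_connected : ∀ m : Fin G, (topology.induce {k | group k = m}).Connected

open Classical in
/-- The neighbours of agent `k` (itself included) that belong to the group of `k`. -/
def Network.groupNbhd {N G : ℕ} (net : Network N G) (k : Fin N) : Finset (Fin N) :=
  Finset.univ.filter fun l => (l = k ∨ net.topology.Adj l k) ∧ net.group l = net.group k

/-- Convex combination coefficients `a_{lk} = A l k`: positive exactly on the in-group
neighbourhoods, and each column sums to one. -/
structure IsCombination {N G : ℕ} (net : Network N G) (A : Matrix (Fin N) (Fin N) ℝ) : Prop where
  pos : ∀ l k, l ∈ net.groupNbhd k → 0 < A l k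
  zero : ∀ l k, l ∉ net.groupNbhd k → A l k = 0
  sum_one : ∀ k, ∑ l, A l k = 1

/-- `p` stacks the group Perron vectors: since `A` is block diagonal over the groups, `A p = p`
says that each block of `p` is fixed by the corresponding block of `A`; each block of `p` is
normalised to have sum one. -/
structure IsPerron {N G : ℕ} (net : Network N G) (A : Matrix (Fin N) (Fin N) ℝ)
    (p : Fin N → ℝ) : Prop where
  eigen : A *ᵥ p = p
  sum_one : ∀ m : Fin G, ∑ k with net.group k = m, p k = 1

/-- The Hessian matrix of `f` at `w`. -/
def hess {M : ℕ} (f : Vec M → ℝ) (w : Vec M) : Matrix (Fin M) (Fin M) ℝ :=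
  Matrix.of fun a b => fderiv ℝ (gradient f) w (EuclideanSpace.single b 1) a

/-- The block diagonal matrix `diag{B_1, …, B_n}`. -/
def blockDiag {n M : ℕ} (B : Fin n → Matrix (Fin M) (Fin M) ℝ) :
    Matrix (Fin n × Fin M) (Fin n × Fin M) ℝ :=
  Matrix.of fun x y => if x.1 = y.1 then B x.1 x.2 y.2 else 0

/-- Conditions on the individual costs `J k` and their minimizers `wo k`. Agents are in the same
cluster when their minimizers coincide, so `same_cluster` says that a group lies in one cluster. -/
structure CostAssumption {N G M : ℕ} (net : Network N G) (J : Fin N → Vec M → ℝ)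
    (wo : Fin N → Vec M) : Prop where
  minimizer : ∀ k, IsMinOn (J k) Set.univ (wo k)
  same_cluster : ∀ k l, net.group k = net.group l → wo k = wo l
  strictConvex : ∀ k, StrictConvexOn ℝ Set.univ (J k)
  differentiable : ∀ k, Differentiable ℝ (J k)
  twice_differentiable : ∀ k, Differentiable ℝ (gradient (J k))
  hess_bounds : ∃ lamL lamU : Fin N → ℝ,
    (∀ k, 0 ≤ lamL k ∧ lamL k ≤ lamU k) ∧
    (∀ k w, (hess (J k) w - lamL k • (1 : Matrix (Fin M) (Fin M) ℝ)).PosSemidef) ∧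
    (∀ k w, (lamU k • (1 : Matrix (Fin M) (Fin M) ℝ) - hess (J k) w).PosSemidef) ∧
    (∀ m : Fin G, ∃ k, net.group k = m ∧ 0 < lamL k)
  hess_lipschitz : ∃ κH : ℝ, 0 ≤ κH ∧ ∀ W₁ W₂ : NetVec N M,
    ‖blockDiag (fun k => hess (J k) (W₁ k)) - blockDiag (fun k => hess (J k) (W₂ k))‖
      ≤ κH * ‖W₁ - W₂‖

/-- The network vector of minimizers. -/
def netMin {N M : ℕ} (wo : Fin N → Vec M) : NetVec N M := WithLp.toLp 2 wo

/-- The network gradient noise at time `i`, for the gradient approximations `gradHat k i`,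
evaluated at a random network vector `W`:
the `k`-th block is `gradHat k i (W k) - ∇ J k (W k)`. -/
def noise {N M : ℕ} {Ω : Type*} (J : Fin N → Vec M → ℝ)
    (gradHat : Fin N → ℕ → Ω → Vec M → Vec M) (i : ℕ) (W : Ω → NetVec N M) (ω : Ω) :
    NetVec N M :=
  WithLp.toLp 2 fun k => gradHat k i ω (W ω k) - gradient (J k) (W ω k)

/-- The conditional covariance of the network gradient noise at time `n + 1`, evaluated at `W`,
given the information `ℱ n`. -/
def condCov {N M : ℕ} {Ω : Type*} {mΩ : MeasurableSpace Ω} (P : Measure Ω) (ℱ : Filtration ℕ mΩ)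
    (J : Fin N → Vec M → ℝ) (gradHat : Fin N → ℕ → Ω → Vec M → Vec M) (n : ℕ)
    (W : Ω → NetVec N M) (ω : Ω) : Matrix (Fin N × Fin M) (Fin N × Fin M) ℝ :=
  Matrix.of fun x y =>
    (P[fun ω' => noise J gradHat (n + 1) W ω' x.1 x.2 * noise J gradHat (n + 1) W ω' y.1 y.2
      | ℱ n]) ω

/-- Conditions on the gradient noise. The conditions are required only at those
`ℱ n`-measurable random vectors `W` that have a finite fourth moment. -/
structure NoiseAssumption {N M : ℕ} {Ω : Type*} {mΩ : MeasurableSpace Ω} (P : Measure Ω)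
    (ℱ : Filtration ℕ mΩ) (J : Fin N → Vec M → ℝ) (wo : Fin N → Vec M)
    (gradHat : Fin N → ℕ → Ω → Vec M → Vec M) (γ : ℝ)
    (Rs : Matrix (Fin N × Fin M) (Fin N × Fin M) ℝ) : Prop where
  adapted : ∀ (n : ℕ) (W : Ω → NetVec N M), StronglyMeasurable[ℱ n] W → MemLp W 4 P →
    StronglyMeasurable[ℱ (n + 1)] (noise J gradHat (n + 1) W)
  martingale_diff : ∀ (n : ℕ) (W : Ω → NetVec N M), StronglyMeasurable[ℱ n] W → MemLp W 4 P →
    P[noise J gradHat (n + 1) W | ℱ n] =ᵐ[P] 0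
  fourth_moment : ∃ α σ : ℝ, 0 ≤ α ∧ 0 ≤ σ ∧
    ∀ (n : ℕ) (W : Ω → NetVec N M), StronglyMeasurable[ℱ n] W → MemLp W 4 P →
      Integrable (fun ω => ‖noise J gradHat (n + 1) W ω‖ ^ 4) P ∧
      ∀ᵐ ω ∂P, (P[fun ω' => ‖noise J gradHat (n + 1) W ω'‖ ^ 4 | ℱ n]) ω
        ≤ α ^ 2 * ‖netMin wo - W ω‖ ^ 4 + σ ^ 4
  cov_exponent : 0 < γ ∧ γ ≤ 4
  cov_lipschitz : ∃ κ : ℝ, 0 ≤ κ ∧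
    ∀ (n : ℕ) (W : Ω → NetVec N M), StronglyMeasurable[ℱ n] W → MemLp W 4 P →
      ∀ᵐ ω ∂P, ‖condCov P ℱ J gradHat n (fun _ => netMin wo) ω - condCov P ℱ J gradHat n W ω‖
        ≤ κ * ‖netMin wo - W ω‖ ^ γ
  cov_limit : ∀ᵐ ω ∂P, Tendsto
    (fun n => ‖condCov P ℱ J gradHat n (fun _ => netMin wo) ω - Rs‖) atTop (𝓝 0)
  cov_posDef : Rs.PosDef

/-- The diffusion (adapt-then-combine) iterates, over the in-group neighbourhoods. -/
def iterates {N G M : ℕ} {Ω : Type*} (net : Network N G) (A : Matrix (Fin N) (Fin N) ℝ)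
    (gradHat : Fin N → ℕ → Ω → Vec M → Vec M) (μ : Fin N → ℝ) (W₀ : Ω → NetVec N M) :
    ℕ → Ω → NetVec N M
  | 0 => W₀
  | n + 1 => fun ω =>
      let w := iterates net A gradHat μ W₀ n ω
      let ψ : Fin N → Vec M := fun l => w l - μ l • gradHat l (n + 1) ω (w l)
      WithLp.toLp 2 fun k => ∑ l ∈ net.groupNbhd k, A l k • ψ l

/-- The largest step-size. -/
def muMax {N : ℕ} (μ : Fin N → ℝ) : ℝ := ⨆ k, μ k

/-- The matrix `diag{μ_1, …, μ_N} ⊗ I_M`. -/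
def stepMatrix {N : ℕ} (M : ℕ) (μ : Fin N → ℝ) : Matrix (Fin N × Fin M) (Fin N × Fin M) ℝ :=
  Matrix.diagonal μ ⊗ₖ (1 : Matrix (Fin M) (Fin M) ℝ)

/-- The matrix `diag{p_1^g, …, p_G^g} ⊗ I_M`, of size `NM × GM`. -/
def perronMatrix {N G : ℕ} (M : ℕ) (net : Network N G) (p : Fin N → ℝ) :
    Matrix (Fin N × Fin M) (Fin G × Fin M) ℝ :=
  (Matrix.of fun (k : Fin N) (m : Fin G) => if net.group k = m then p k else 0)
    ⊗ₖ (1 : Matrix (Fin M) (Fin M) ℝ)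

/-- The weighted group Hessian `∑_{k in group m} (p_k μ_k / μ_max) ∇²J_k(w_k^o)`. -/
def groupHess {N G M : ℕ} (net : Network N G) (J : Fin N → Vec M → ℝ) (wo : Fin N → Vec M)
    (p μ : Fin N → ℝ) (m : Fin G) : Matrix (Fin M) (Fin M) ℝ :=
  ∑ k with net.group k = m, (p k * μ k / muMax μ) • hess (J k) (wo k)

/-- The coefficient matrix `diag{D_1, …, D_G}`, with `D_m` the identity minus `μ_max` times the
weighted Hessian of group `m`. -/
def lowMatrix {N G M : ℕ} (net : Network N G) (J : Fin N → Vec M → ℝ) (wo : Fin N → Vec M)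
    (p μ : Fin N → ℝ) : Matrix (Fin G × Fin M) (Fin G × Fin M) ℝ :=
  blockDiag fun m => 1 - muMax μ • groupHess net J wo p μ m

/-- The low-dimensional (centroid) error recursion, driven by the gradient noise along the
diffusion iterates. -/
def lowError {N G M : ℕ} {Ω : Type*} (net : Network N G) (A : Matrix (Fin N) (Fin N) ℝ)
    (J : Fin N → Vec M → ℝ) (wo : Fin N → Vec M) (gradHat : Fin N → ℕ → Ω → Vec M → Vec M)
    (p μ : Fin N → ℝ) (W₀ : Ω → NetVec N M) (X₀ : Ω → EuclideanSpace ℝ (Fin G × Fin M)) :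
    ℕ → Ω → EuclideanSpace ℝ (Fin G × Fin M)
  | 0 => X₀
  | n + 1 => fun ω =>
      let x := lowError net A J wo gradHat p μ W₀ X₀ n ω
      let s := noise J gradHat (n + 1) (iterates net A gradHat μ W₀ n) ω
      WithLp.toLp 2
        (lowMatrix net J wo p μ *ᵥ (x : Fin G × Fin M → ℝ)
          + ((perronMatrix M net p)ᵀ * stepMatrix M μ) *ᵥ fun y => s y.1 y.2)

/-- The second-moment matrix `E[X Xᵀ]`. -/
def secondMoment {Ω ι : Type*} [MeasurableSpace Ω] [Fintype ι] (P : Measure Ω)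
    (X : Ω → EuclideanSpace ℝ ι) : Matrix ι ι ℝ :=
  Matrix.of fun x y => ∫ ω, X ω x * X ω y ∂P

/-- `Θ` solves the discrete Lyapunov equation `Θ = D Θ D + Pᵀ M R_s M P`. -/
def IsLyapunov {N G M : ℕ} (net : Network N G) (J : Fin N → Vec M → ℝ) (wo : Fin N → Vec M)
    (p μ : Fin N → ℝ) (Rs : Matrix (Fin N × Fin M) (Fin N × Fin M) ℝ)
    (Θ : Matrix (Fin G × Fin M) (Fin G × Fin M) ℝ) : Prop :=
  Θ = lowMatrix net J wo p μ * Θ * lowMatrix net J wo p μ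
    + (perronMatrix M net p)ᵀ * stepMatrix M μ * Rs * stepMatrix M μ * perronMatrix M net p

end DiffusionNet

end

namespace DiffusionNet

section Perron

variable {N G : ℕ} {net : Network N G} {A : Matrix (Fin N) (Fin N) ℝ}

lemma Network.mem_groupNbhd {k l : Fin N} :
    l ∈ net.groupNbhd k ↔ (l = k ∨ net.topology.Adj l k) ∧ net.group l = net.group k := by
  simp [Network.groupNbhd]

/-- A property that spreads along the edges inside groups holds on a whole group as soon as it
holds at one of its agents. -/
lemma Network.group_induction (net : Network N G) {S : Fin N → Prop}
    (hS : ∀ k l, S k → l ∈ net.groupNbhd k → S l) {k l : Fin N} (hk : S k)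
    (hkl : net.group l = net.group k) : S l := by
  have hconn := (net.group_connected (net.group k)).preconnected
  have h := hconn ⟨k, rfl⟩ ⟨l, hkl⟩
  obtain ⟨w⟩ := h
  have key : ∀ {u v : {j // net.group j = net.group k}},
      (net.topology.induce {j | net.group j = net.group k}).Walk u v → S u.1 → S v.1 := by
    intro u v w
    induction w with
    | nil => exact id
    | @cons a b _ hadj _ ih =>
      intro hu
      exact ih (hS _ _ hu (Network.mem_groupNbhd.2
        ⟨Or.inr (SimpleGraph.induce_adj.1 hadj).symm, b.2.trans a.2.symm⟩))
  exact key w hk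

lemma IsCombination.nonneg (hA : IsCombination net A) (l k : Fin N) : 0 ≤ A l k := by
  by_cases h : l ∈ net.groupNbhd k
  · exact (hA.pos l k h).le
  · exact (hA.zero l k h).ge

lemma IsCombination.sum_groupNbhd (hA : IsCombination net A) {E : Type*} [AddCommGroup E]
    [Module ℝ E] (k : Fin N) (f : Fin N → E) :
    ∑ l ∈ net.groupNbhd k, A l k • f l = ∑ l, A l k • f l :=
  Finset.sum_subset (Finset.subset_univ _) fun l _ hl => by rw [hA.zero l k hl, zero_smul]

/-- Maximum principle: a function that is harmonic for the combination weights is constant on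
every group. -/
lemma IsCombination.harmonic_const (hA : IsCombination net A) {v : Fin N → ℝ}
    (hv : ∀ k, ∑ l, A l k * v l = v k) {k l : Fin N} (hkl : net.group k = net.group l) :
    v k = v l := by
  classical
  obtain ⟨k₀, hk₀, hmax⟩ := Finset.exists_max_image
    (Finset.univ.filter fun j => net.group j = net.group l) v ⟨l, by simp⟩
  have hk₀' : net.group k₀ = net.group l := by simpa using hk₀
  have hmax' : ∀ j, net.group j = net.group l → v j ≤ v k₀ := fun j hj => hmax j (by simp [hj])
  have hstep : ∀ j i, (v j = v k₀ ∧ net.group j = net.group l) → i ∈ net.groupNbhd j →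
      (v i = v k₀ ∧ net.group i = net.group l) := by
    rintro j i ⟨hj, hjg⟩ hi
    have hig := (Network.mem_groupNbhd.1 hi).2.trans hjg
    refine ⟨?_, hig⟩
    have hsum : ∑ x, A x j * (v k₀ - v x) = 0 := by
      simp_rw [mul_sub]
      rw [Finset.sum_sub_distrib, hv j, ← Finset.sum_mul, hA.sum_one, hj]; ring
    have hnn : ∀ x ∈ Finset.univ, 0 ≤ A x j * (v k₀ - v x) := by
      intro x _
      by_cases hx : x ∈ net.groupNbhd j
      · exact mul_nonneg (hA.nonneg _ _)
          (sub_nonneg.2 (hmax' x ((Network.mem_groupNbhd.1 hx).2.trans hjg)))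
      · simp [hA.zero x j hx]
    have := (Finset.sum_eq_zero_iff_of_nonneg hnn).1 hsum i (Finset.mem_univ _)
    rcases mul_eq_zero.1 this with h | h
    · exact absurd h (hA.pos i j hi).ne'
    · linarith
  have h1 := net.group_induction hstep (k := k₀) (l := k) ⟨rfl, hk₀'⟩ (hkl.trans hk₀'.symm)
  have h2 := net.group_induction hstep (k := k₀) (l := l) ⟨rfl, hk₀'⟩ hk₀'.symm
  exact h1.1.trans h2.1.symm

lemma IsCombination.sum_mulVec (hA : IsCombination net A) (x : Fin N → ℝ) :
    ∑ l, (A *ᵥ x) l = ∑ k, x k := by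
  simp only [Matrix.mulVec, dotProduct]
  rw [Finset.sum_comm]
  refine Finset.sum_congr rfl fun k _ => ?_
  rw [← Finset.sum_mul, hA.sum_one, one_mul]

lemma IsPerron.pos (hA : IsCombination net A) {p : Fin N → ℝ} (hp : IsPerron net A p)
    (l : Fin N) : 0 < p l := by
  have hAp : ∀ l, ∑ k, A l k * p k = p l := fun l => congrFun hp.eigen l
  have hle : ∀ l ∈ Finset.univ, |p l| ≤ (A *ᵥ fun k => |p k|) l := by
    intro l _
    conv_lhs => rw [← hAp l]
    refine (Finset.abs_sum_le_sum_abs _ _).trans (le_of_eq ?_)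
    simp only [Matrix.mulVec, dotProduct, abs_mul, abs_of_nonneg (hA.nonneg _ _)]
  have habs := (Finset.sum_eq_sum_iff_of_le hle).1 (hA.sum_mulVec _).symm
  have hu : ∀ l, ∑ k, A l k * (|p k| + p k) = |p l| + p l := by
    intro l
    simp_rw [mul_add]
    rw [Finset.sum_add_distrib, hAp l, habs l (Finset.mem_univ _)]
    rfl
  have hu0 : ∀ k, 0 ≤ |p k| + p k := fun k => by linarith [neg_abs_le (p k)]
  by_contra hl
  have hl0 : |p l| + p l = 0 := by rw [abs_of_nonpos (not_lt.1 hl)]; ring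
  have hall : ∀ k, net.group k = net.group l → |p k| + p k = 0 := by
    intro k hk
    refine net.group_induction (S := fun k => |p k| + p k = 0) ?_ hl0 hk
    intro j i hj hi
    have hsum := (hu j).trans hj
    have := (Finset.sum_eq_zero_iff_of_nonneg
      fun x _ => mul_nonneg (hA.nonneg j x) (hu0 x)).1 hsum i (Finset.mem_univ _)
    have hij : j ∈ net.groupNbhd i := by
      rw [Network.mem_groupNbhd] at hi ⊢
      exact ⟨hi.1.imp Eq.symm SimpleGraph.Adj.symm, hi.2.symm⟩
    exact (mul_eq_zero.1 this).resolve_left (hA.pos j i hij).ne'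
  have h1 := hp.sum_one (net.group l)
  have h2 : ∑ k with net.group k = net.group l, p k ≤ 0 := by
    refine Finset.sum_nonpos fun k hk => ?_
    have := hall k (by simpa using hk)
    linarith [abs_nonneg (p k)]
  linarith

/-- Fredholm alternative for the combination matrix: vectors with zero group sums lie in the range
of `1 - A`. -/
lemma IsCombination.exists_sub_mulVec_eq (hA : IsCombination net A) {h : Fin N → ℝ}
    (hh : ∀ m : Fin G, ∑ k with net.group k = m, h k = 0) :
    ∃ r : Fin N → ℝ, ∀ l, r l - (A *ᵥ r) l = h l := by
  classical
  suffices h ∈ LinearMap.range (Matrix.toLin' (1 - A)) by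
    obtain ⟨r, hr⟩ := this
    refine ⟨r, fun l => ?_⟩
    rw [← hr]
    simp
  by_contra hn
  obtain ⟨f, hf, hle⟩ := Submodule.exists_le_ker_of_notMem hn
  apply hf
  set v : Fin N → ℝ := fun k => f (Pi.single k 1) with hvdef
  have hfv : ∀ x, f x = ∑ k, x k * v k := fun x => by
    conv_lhs => rw [pi_eq_sum_univ' x]
    simp [map_sum, hvdef]
  have hharm : ∀ k, ∑ l, A l k * v l = v k := by
    intro k
    have h0 : f (Matrix.toLin' (1 - A) (Pi.single k 1)) = 0 := hle ⟨_, rfl⟩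
    rw [Matrix.toLin'_apply, Matrix.sub_mulVec, map_sub, Matrix.one_mulVec, sub_eq_zero, hfv
      (A *ᵥ _)] at h0
    rw [hvdef]
    simpa using h0.symm
  rw [hfv, ← Finset.sum_fiberwise _ net.group]
  refine Finset.sum_eq_zero fun m _ => ?_
  by_cases hne : ∃ k, net.group k = m
  · obtain ⟨k, hk⟩ := hne
    have : ∀ x ∈ Finset.univ.filter (fun x => net.group x = m), h x * v x = h x * v k := by
      intro x hx
      rw [hA.harmonic_const hharm (((Finset.mem_filter.1 hx).2).trans hk.symm)]
    rw [Finset.sum_congr rfl this, ← Finset.sum_mul, hh, zero_mul]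
  · rw [Finset.sum_eq_zero]
    intro x hx
    exact absurd ⟨x, (Finset.mem_filter.1 hx).2⟩ hne

lemma exists_pos_le {n : ℕ} {f : Fin n → ℝ} (hf : ∀ i, 0 < f i) : ∃ c > 0, ∀ i, c ≤ f i := by
  rcases isEmpty_or_nonempty (Fin n) with h | h
  · exact ⟨1, one_pos, fun i => h.elim i⟩
  · obtain ⟨i, hi⟩ := Finite.exists_min f
    exact ⟨f i, hf i, hi⟩

lemma exists_pos_ge {n : ℕ} (f : Fin n → ℝ) : ∃ c > 0, ∀ i, f i ≤ c := by
  obtain ⟨c, hc⟩ := (Set.finite_range f).bddAbove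
  exact ⟨max c 1, by positivity, fun i => (hc ⟨i, rfl⟩).trans (le_max_left _ _)⟩

/-- Weights `q`, a perturbation of the Perron vector, for which one combination step together with
the individual contractions `1 - t λ_l` (some of which may be trivial) is a strict contraction. -/
lemma IsPerron.exists_contracting_weights (hA : IsCombination net A) {p : Fin N → ℝ}
    (hp : IsPerron net A p) {lam : Fin N → ℝ} (hlam : ∀ k, 0 ≤ lam k)
    (hgroup : ∀ m : Fin G, ∃ k, net.group k = m ∧ 0 < lam k) :
    ∃ δ > 0, ∃ qlo > 0, ∃ qhi : ℝ, ∀ᶠ t in 𝓝[>] (0 : ℝ), ∃ q : Fin N → ℝ,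
      (∀ l, qlo ≤ q l ∧ q l ≤ qhi) ∧ ∀ l, (A *ᵥ q) l * (1 - t * lam l) ≤ (1 - δ * t) * q l := by
  have hpp := hp.pos hA
  set c : Fin G → ℝ := fun m => ∑ k with net.group k = m, lam k * p k with hc
  have hcpos : ∀ m, 0 < c m := by
    intro m
    obtain ⟨k, hk, hk0⟩ := hgroup m
    exact Finset.sum_pos' (fun j _ => mul_nonneg (hlam j) (hpp j).le)
      ⟨k, by simp [hk], mul_pos hk0 (hpp k)⟩
  obtain ⟨r, hr⟩ := hA.exists_sub_mulVec_eq
    (h := fun l => c (net.group l) * p l - lam l * p l) (by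
      intro m
      rw [Finset.sum_sub_distrib, sub_eq_zero]
      have : ∀ k ∈ Finset.univ.filter (fun k => net.group k = m),
          c (net.group k) * p k = c m * p k := by
        intro k hk
        rw [(Finset.mem_filter.1 hk).2]
      rw [Finset.sum_congr rfl this, ← Finset.mul_sum, hp.sum_one, mul_one])
  obtain ⟨d, hd, hdc⟩ := exists_pos_le hcpos
  obtain ⟨plo, hplo, hple⟩ := exists_pos_le hpp
  obtain ⟨phi, -, hphi⟩ := exists_pos_ge p
  refine ⟨d / 2, by positivity, plo / 2, by positivity, phi + 1, ?_⟩
  have hcont : ∀ (f : ℝ → ℝ), Continuous f → 0 < f 0 → ∀ᶠ t in 𝓝[>] (0 : ℝ), 0 < f t :=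
    fun f hf h0 => nhdsWithin_le_nhds (hf.continuousAt.eventually_const_lt h0)
  have h1 : ∀ᶠ t in 𝓝[>] (0 : ℝ), ∀ l, 0 < p l + t * r l - plo / 2 :=
    eventually_all.2 fun l => hcont _ (by fun_prop) (by simp; linarith [hple l])
  have h2 : ∀ᶠ t in 𝓝[>] (0 : ℝ), ∀ l, 0 < phi + 1 - (p l + t * r l) :=
    eventually_all.2 fun l => hcont _ (by fun_prop) (by simp; linarith [hphi l])
  have h3 : ∀ᶠ t in 𝓝[>] (0 : ℝ), ∀ l, 0 < c (net.group l) * p l - d / 2 * p l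
      - t * (d / 2 * r l + lam l * (c (net.group l) * p l) - lam l * r l
        - lam l * (lam l * p l)) := by
    refine eventually_all.2 fun l => hcont _ (by fun_prop) ?_
    have := hdc (net.group l)
    have := hpp l
    nlinarith
  filter_upwards [h1, h2, h3, self_mem_nhdsWithin] with t h1 h2 h3 (ht : 0 < t)
  refine ⟨fun l => p l + t * r l, fun l => ⟨by linarith [h1 l], by linarith [h2 l]⟩, fun l => ?_⟩
  have hAq : (A *ᵥ fun l => p l + t * r l) l
      = p l + t * (r l - (c (net.group l) * p l - lam l * p l)) := by
    have : (fun l => p l + t * r l) = p + t • r := rfl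
    rw [this, Matrix.mulVec_add, Matrix.mulVec_smul, hp.eigen, ← hr l]
    simp
  rw [hAq]
  nlinarith [h3 l, mul_pos ht (h3 l)]

end Perron

section MatrixBounds

variable {n : Type*} [Fintype n]

lemma dotProduct_self_eq_norm_sq (x : EuclideanSpace ℝ n) : x.ofLp ⬝ᵥ x.ofLp = ‖x‖ ^ 2 := by
  rw [EuclideanSpace.norm_sq_eq, dotProduct]
  exact Finset.sum_congr rfl fun i _ => by rw [Real.norm_eq_abs, sq_abs, sq]

variable [DecidableEq n]

/-- A matrix with `0 ≤ T ≤ c I` has norm at most `c`. -/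
lemma l2_opNorm_le_of_posSemidef {T : Matrix n n ℝ} {c : ℝ} (hc : 0 < c) (hT : T.PosSemidef)
    (hTc : (c • (1 : Matrix n n ℝ) - T).PosSemidef) : ‖T‖ ≤ c := by
  rw [Matrix.cstar_norm_def]
  refine ContinuousLinearMap.opNorm_le_bound _ hc.le fun x => ?_
  set y : EuclideanSpace ℝ n := Matrix.toEuclideanCLM (n := n) (𝕜 := ℝ) T x with hy
  have hyx : y.ofLp = T *ᵥ x.ofLp := rfl
  have hle : ∀ z : EuclideanSpace ℝ n, z.ofLp ⬝ᵥ T *ᵥ z.ofLp ≤ c * ‖z‖ ^ 2 := by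
    intro z
    have := hTc.dotProduct_mulVec_nonneg z.ofLp
    rw [star_trivial, Matrix.sub_mulVec, dotProduct_sub, Matrix.smul_mulVec, Matrix.one_mulVec,
      dotProduct_smul, dotProduct_self_eq_norm_sq, smul_eq_mul] at this
    linarith
  have hsymm : ∀ u v : n → ℝ, u ⬝ᵥ T *ᵥ v = (T *ᵥ u) ⬝ᵥ v := by
    intro u v
    have ht : Tᵀ = T := by simpa [Matrix.IsHermitian] using hT.1
    rw [Matrix.dotProduct_mulVec, ← Matrix.mulVec_transpose, ht]
  have h0 := hT.dotProduct_mulVec_nonneg (c • x.ofLp - y.ofLp)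
  have hxy : x.ofLp ⬝ᵥ T *ᵥ y.ofLp = ‖y‖ ^ 2 := by
    rw [hsymm, ← hyx, dotProduct_self_eq_norm_sq]
  have hyy : y.ofLp ⬝ᵥ T *ᵥ x.ofLp = ‖y‖ ^ 2 := by
    rw [← hyx, dotProduct_self_eq_norm_sq]
  rw [star_trivial, Matrix.mulVec_sub, Matrix.mulVec_smul] at h0
  simp only [sub_dotProduct, dotProduct_sub, smul_dotProduct, dotProduct_smul, smul_eq_mul, hxy,
    hyy] at h0
  have h1 := hle y
  have h2 := hle x
  have h3 : ‖y‖ ^ 2 ≤ (c * ‖x‖) ^ 2 := by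
    have : c * ‖y‖ ^ 2 ≤ c * (c * ‖x‖) ^ 2 := by nlinarith [sq_pos_of_pos hc]
    exact le_of_mul_le_mul_left this hc
  exact (pow_le_pow_iff_left₀ (norm_nonneg _) (by positivity) two_ne_zero).1 h3

lemma toEuclideanLin_norm_le {m : Type*} [Fintype m] (B : Matrix m n ℝ) (x : n → ℝ) :
    ‖(WithLp.toLp 2 (B *ᵥ x) : EuclideanSpace ℝ m)‖
      ≤ ‖B‖ * ‖(WithLp.toLp 2 x : EuclideanSpace ℝ n)‖ :=
  Matrix.l2_opNorm_mulVec B (WithLp.toLp 2 x)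

lemma abs_entry_le_l2_opNorm {m : Type*} [Fintype m] (B : Matrix m n ℝ) (i : m) (j : n) :
    |B i j| ≤ ‖B‖ := by
  have h := toEuclideanLin_norm_le B (Pi.single j 1)
  have h2 := PiLp.norm_apply_le (WithLp.toLp 2 (B *ᵥ Pi.single j 1) : EuclideanSpace ℝ m) i
  have h3 : ‖(WithLp.toLp 2 (Pi.single j 1) : EuclideanSpace ℝ n)‖ = 1 := by
    simp
  rw [h3, mul_one] at h
  simpa using h2.trans h

lemma l2_opNorm_le_of_entries {m : Type*} [Fintype m] [DecidableEq m] {B : Matrix m n ℝ} {b : ℝ}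
    (hB : ∀ i j, |B i j| ≤ b) :
    ‖B‖ ≤ Fintype.card m * Fintype.card n * b := by
  have hsingle : ∀ i j, ‖Matrix.single i j (B i j)‖ ≤ b := by
    intro i j
    refine le_trans ?_ (hB i j)
    rw [Matrix.l2_opNorm_def]
    refine ContinuousLinearMap.opNorm_le_bound _ (abs_nonneg _) fun x => ?_
    have : (Matrix.toEuclideanLin.trans LinearMap.toContinuousLinearMap)
        (Matrix.single i j (B i j)) x = EuclideanSpace.single i (B i j * x j) := by
      ext k
      simp [Matrix.toEuclideanLin, Matrix.mulVec, dotProduct, Matrix.single_apply,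
        ite_and, eq_comm]
    rw [this, PiLp.norm_single, norm_mul]
    exact mul_le_mul_of_nonneg_left (PiLp.norm_apply_le x j) (norm_nonneg _)
  calc ‖B‖ = ‖∑ i, ∑ j, Matrix.single i j (B i j)‖ := by rw [← Matrix.matrix_eq_sum_single]
    _ ≤ ∑ _i : m, ∑ _j : n, b := norm_sum_le_of_le _ fun i _ => norm_sum_le_of_le _ fun j _ =>
        hsingle i j
    _ = _ := by simp [mul_assoc]

lemma dotProduct_blockDiag {N M : ℕ} (B : Fin N → Matrix (Fin M) (Fin M) ℝ)
    (x : Fin N × Fin M → ℝ) :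
    x ⬝ᵥ blockDiag B *ᵥ x = ∑ k, (fun a => x (k, a)) ⬝ᵥ B k *ᵥ fun a => x (k, a) := by
  simp [dotProduct, Matrix.mulVec, blockDiag, Fintype.sum_prod_type]

end MatrixBounds

lemma posSemidef_blockDiag {N M : ℕ} {B : Fin N → Matrix (Fin M) (Fin M) ℝ}
    (hB : ∀ k, (B k).PosSemidef) : (blockDiag B).PosSemidef := by
  refine .of_dotProduct_mulVec_nonneg ?_ fun x => ?_
  · ext ⟨k, a⟩ ⟨l, b⟩
    rcases eq_or_ne k l with rfl | h
    · simpa [blockDiag] using congrFun (congrFun (hB k).1 a) b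
    · simp [blockDiag, h, h.symm]
  · rw [star_trivial, dotProduct_blockDiag]
    exact Finset.sum_nonneg fun k _ => by
      simpa using (hB k).dotProduct_mulVec_nonneg fun a => x (k, a)

section Lyapunov

variable {n : Type*} [Fintype n] [DecidableEq n]

/-- Solvability of the discrete Lyapunov equation for a symmetric contraction. -/
lemma exists_lyapunov {D Q : Matrix n n ℝ} (hD : Dᵀ = D) (hD1 : ‖D‖ < 1) (hQ : Q.PosDef) :
    ∃ Θ : Matrix n n ℝ, Θ.IsSymm ∧ Θ.PosDef ∧ Θ = D * Θ * D + Q ∧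
      ∀ Θ' : Matrix n n ℝ, Θ' = D * Θ' * D + Q → Θ' = Θ := by
  set L : Matrix n n ℝ →ₗ[ℝ] Matrix n n ℝ :=
    LinearMap.id - LinearMap.mulLeft ℝ D ∘ₗ LinearMap.mulRight ℝ D with hL
  have hLX : ∀ X, L X = X - D * X * D := fun X => by simp [hL, mul_assoc]
  have hinj : Function.Injective L := by
    rw [← LinearMap.ker_eq_bot, LinearMap.ker_eq_bot']
    intro X hX
    rw [hLX, sub_eq_zero] at hX
    by_contra hne
    have hpos : 0 < ‖X‖ := norm_pos_iff.2 hne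
    have h1 : ‖X‖ ≤ ‖D‖ * ‖X‖ * ‖D‖ := by
      calc ‖X‖ = ‖D * X * D‖ := congrArg _ hX
        _ ≤ _ := (norm_mul_le _ _).trans (mul_le_mul_of_nonneg_right (norm_mul_le _ _)
          (norm_nonneg _))
    have h2 : ‖D‖ * ‖D‖ < 1 := by nlinarith [norm_nonneg D]
    nlinarith
  obtain ⟨Θ, hΘ⟩ := (LinearMap.injective_iff_surjective.1 hinj) Q
  rw [hLX, sub_eq_iff_eq_add'] at hΘ
  have huniq : ∀ Θ' : Matrix n n ℝ, Θ' = D * Θ' * D + Q → Θ' = Θ := by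
    intro Θ' h
    apply hinj
    rw [hLX, hLX]
    nth_rewrite 1 [h]
    nth_rewrite 1 [hΘ]
    abel
  have hQt : Qᵀ = Q := by simpa [Matrix.IsHermitian] using hQ.1
  have hsymm : Θ.IsSymm := by
    refine huniq _ ?_
    nth_rewrite 1 [hΘ]
    rw [Matrix.transpose_add, Matrix.transpose_mul, Matrix.transpose_mul, hD, hQt, mul_assoc]
  refine ⟨Θ, hsymm, ?_, hΘ, huniq⟩
  have hstep : ∀ x : n → ℝ, x ⬝ᵥ Θ *ᵥ x = (D *ᵥ x) ⬝ᵥ Θ *ᵥ (D *ᵥ x) + x ⬝ᵥ Q *ᵥ x := by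
    intro x
    nth_rewrite 1 [hΘ]
    rw [Matrix.add_mulVec, dotProduct_add, ← Matrix.mulVec_mulVec, ← Matrix.mulVec_mulVec,
      Matrix.dotProduct_mulVec, ← Matrix.mulVec_transpose, hD]
  have hQ0 : ∀ x : n → ℝ, 0 ≤ x ⬝ᵥ Q *ᵥ x := fun x => by
    simpa using hQ.posSemidef.dotProduct_mulVec_nonneg x
  have hiter : ∀ (x : n → ℝ) (i : ℕ), ((D ^ i) *ᵥ x) ⬝ᵥ Θ *ᵥ ((D ^ i) *ᵥ x) ≤ x ⬝ᵥ Θ *ᵥ x := by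
    intro x i
    induction i with
    | zero => simp
    | succ i ih =>
      refine le_trans ?_ ih
      rw [hstep ((D ^ i) *ᵥ x), pow_succ', ← Matrix.mulVec_mulVec]
      linarith [hQ0 ((D ^ i) *ᵥ x)]
  have hlim : ∀ x : n → ℝ, Tendsto
      (fun i : ℕ => ((D ^ i) *ᵥ x) ⬝ᵥ Θ *ᵥ ((D ^ i) *ᵥ x)) atTop (𝓝 0) := by
    intro x
    have h1 : Tendsto (fun i : ℕ => D ^ i) atTop (𝓝 0) :=
      tendsto_pow_atTop_nhds_zero_of_norm_lt_one hD1
    have h2 : Continuous fun E : Matrix n n ℝ => (E *ᵥ x) ⬝ᵥ Θ *ᵥ (E *ᵥ x) := by fun_prop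
    have h3 := (h2.tendsto 0).comp h1
    rwa [Matrix.zero_mulVec, zero_dotProduct] at h3
  have hnn : ∀ x : n → ℝ, 0 ≤ x ⬝ᵥ Θ *ᵥ x := fun x =>
    le_of_tendsto' (hlim x) (hiter x)
  refine .of_dotProduct_mulVec_pos (by simpa [Matrix.IsHermitian] using hsymm.eq) fun x hx => ?_
  rw [star_trivial, hstep]
  have := hQ.dotProduct_mulVec_pos hx
  rw [star_trivial] at this
  linarith [hnn (D *ᵥ x)]

end Lyapunov

section Gradient

variable {M : ℕ} {f : Vec M → ℝ}

lemma fderiv_gradient_eq (w : Vec M) :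
    fderiv ℝ (gradient f) w = Matrix.toEuclideanCLM (n := Fin M) (𝕜 := ℝ) (hess f w) := by
  apply ContinuousLinearMap.coe_injective
  refine (EuclideanSpace.basisFun (Fin M) ℝ).toBasis.ext fun b => ?_
  ext a
  simp [hess]

/-- The gradient step contracts by the factor `1 - μ a` when `a I ≤ ∇²f ≤ b I` and `μ b < 1`. -/
lemma norm_gradient_step_sub_le (hf : Differentiable ℝ (gradient f)) {a b μ : ℝ}
    (hL : ∀ w, (hess f w - a • (1 : Matrix (Fin M) (Fin M) ℝ)).PosSemidef)
    (hU : ∀ w, (b • (1 : Matrix (Fin M) (Fin M) ℝ) - hess f w).PosSemidef)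
    (hab : a ≤ b) (hμ : 0 ≤ μ) (hμb : μ * b < 1) (w w' : Vec M) :
    ‖(w - μ • gradient f w) - (w' - μ • gradient f w')‖ ≤ (1 - μ * a) * ‖w - w'‖ := by
  have hμa : μ * a ≤ μ * b := mul_le_mul_of_nonneg_left hab hμ
  have hder : ∀ v, HasFDerivAt (fun w => w - μ • gradient f w)
      (ContinuousLinearMap.id ℝ _ - μ • fderiv ℝ (gradient f) v) v := fun v =>
    (hasFDerivAt_id v).sub ((hf v).hasFDerivAt.const_smul μ)
  have hbound : ∀ v, ‖ContinuousLinearMap.id ℝ (Vec M) - μ • fderiv ℝ (gradient f) v‖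
      ≤ 1 - μ * a := by
    intro v
    have heq : ContinuousLinearMap.id ℝ (Vec M) - μ • fderiv ℝ (gradient f) v
        = Matrix.toEuclideanCLM (n := Fin M) (𝕜 := ℝ) (1 - μ • hess f v) := by
      rw [fderiv_gradient_eq, map_sub, map_smul, map_one]
      rfl
    rw [heq, ← Matrix.cstar_norm_def]
    refine l2_opNorm_le_of_posSemidef (by linarith) ?_ ?_
    · have h := ((hU v).smul hμ).add
        ((Matrix.PosSemidef.one (n := Fin M) (R := ℝ)).smul (sub_nonneg.2 hμb.le))
      convert h using 1
      simp only [smul_sub, sub_smul, smul_smul, one_smul]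
      abel
    · convert (hL v).smul hμ using 1
      simp only [smul_sub, sub_smul, smul_smul, one_smul]
      abel
  exact Convex.norm_image_sub_le_of_norm_hasFDerivWithin_le
    (fun v _ => (hder v).hasFDerivWithinAt) (fun v _ => hbound v) convex_univ
    (Set.mem_univ w') (Set.mem_univ w)

lemma gradient_eq_zero_of_isMinOn {w : Vec M} (hw : IsMinOn f Set.univ w) : gradient f w = 0 := by
  have h : IsLocalMin f w := hw.isLocalMin univ_mem
  simp [gradient, h.fderiv_eq_zero]

end Gradient

lemma eventually_le_of_recursion {a : ℕ → ℝ} {ρ b : ℝ} (hρ : 0 ≤ ρ) (hρ1 : ρ < 1) (hb : 0 < b)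
    (h : ∀ᶠ n in atTop, a (n + 1) ≤ ρ * a n + b) : ∀ᶠ n in atTop, a n ≤ 2 * b / (1 - ρ) := by
  obtain ⟨n₀, hn₀⟩ := eventually_atTop.1 h
  have h1ρ : 0 < 1 - ρ := sub_pos.2 hρ1
  have hiter : ∀ k, a (n₀ + k) ≤ ρ ^ k * |a n₀| + b / (1 - ρ) := by
    intro k
    induction k with
    | zero =>
      have : 0 ≤ b / (1 - ρ) := by positivity
      simpa using (le_abs_self _).trans (le_add_of_nonneg_right this)
    | succ k ih =>
      calc a (n₀ + (k + 1)) ≤ ρ * a (n₀ + k) + b := hn₀ (n₀ + k) (by omega)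
        _ ≤ ρ * (ρ ^ k * |a n₀| + b / (1 - ρ)) + b := by gcongr
        _ = ρ ^ (k + 1) * |a n₀| + b / (1 - ρ) := by field_simp; ring
  have hlim : Tendsto (fun k => ρ ^ k * |a n₀| + b / (1 - ρ)) atTop (𝓝 (b / (1 - ρ))) := by
    simpa using ((tendsto_pow_atTop_nhds_zero_of_lt_one hρ hρ1).mul_const |a n₀|).add_const
      (b / (1 - ρ))
  have hlt : b / (1 - ρ) < 2 * b / (1 - ρ) := by
    gcongr; linarith
  obtain ⟨k₀, hk₀⟩ := eventually_atTop.1 (hlim.eventually_lt_const hlt)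
  filter_upwards [eventually_ge_atTop (n₀ + k₀)] with n hn
  obtain ⟨k, rfl⟩ := Nat.exists_eq_add_of_le (show n₀ ≤ n by omega)
  exact (hiter k).trans (hk₀ k (by omega)).le

section FourthPower

variable {E : Type*} [NormedAddCommGroup E] [InnerProductSpace ℝ E]

lemma norm_sub_smul_pow_four_le (x s : E) {μ t ε : ℝ} (hμ : 0 ≤ μ) (hμt : μ ≤ t) (ht : 0 < t)
    (ht1 : t ≤ 1) (hε : 0 < ε) :
    ‖x - μ • s‖ ^ 4 ≤ (1 + ε * t) * ‖x‖ ^ 4 - 4 * μ * inner ℝ (‖x‖ ^ 2 • x) s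
      + (16 / ε + 3) * t ^ 3 * ‖s‖ ^ 4 := by
  have h1 : ‖x - μ • s‖ ^ 2 = ‖x‖ ^ 2 - 2 * (μ * inner ℝ x s) + μ ^ 2 * ‖s‖ ^ 2 := by
    rw [norm_sub_sq_real, inner_smul_right, norm_smul, Real.norm_of_nonneg hμ]; ring
  have h2 : |inner ℝ x s| ≤ ‖x‖ * ‖s‖ := abs_real_inner_le_norm x s
  have h3 : ‖x - μ • s‖ ^ 4 = (‖x‖ ^ 2 - 2 * (μ * inner ℝ x s) + μ ^ 2 * ‖s‖ ^ 2) ^ 2 := by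
    rw [← h1]; ring
  rw [h3, inner_smul_left]
  simp only [conj_trivial]
  generalize inner ℝ x s = c at *
  generalize ‖x‖ = a at *
  obtain ⟨b, hb⟩ : ∃ b, b = ‖s‖ := ⟨_, rfl⟩
  have hb0 : 0 ≤ b := hb ▸ norm_nonneg s
  rw [← hb] at h2 ⊢
  have hc2 : c ^ 2 ≤ (a * b) ^ 2 := sq_le_sq' (abs_le.1 h2).1 (abs_le.1 h2).2
  have hcd : (μ * c) ^ 2 ≤ (a * (μ * b)) ^ 2 := by
    have := mul_le_mul_of_nonneg_left hc2 (sq_nonneg μ)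
    nlinarith
  have h4 : (a ^ 2 - 2 * (μ * c) + μ ^ 2 * b ^ 2) ^ 2
      ≤ a ^ 4 - 4 * μ * (a ^ 2 * c) + 8 * a ^ 2 * (μ * b) ^ 2 + 3 * (μ * b) ^ 4 := by
    nlinarith [sq_nonneg (μ * c + (μ * b) ^ 2), sq_nonneg (a * (μ * b))]
  have h5 : 8 * a ^ 2 * (μ * b) ^ 2 ≤ ε * t * a ^ 4 + 16 / ε * t ^ 3 * b ^ 4 := by
    have h6 : 8 * a ^ 2 * (μ * b) ^ 2 ≤ 8 * a ^ 2 * (t * b) ^ 2 := by gcongr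
    have h7 : ε * t * a ^ 4 + 16 / ε * t ^ 3 * b ^ 4 - 8 * a ^ 2 * (t * b) ^ 2
        = t / ε * (ε * a ^ 2 - 4 * t * b ^ 2) ^ 2 := by field_simp; ring
    have h8 : 0 ≤ t / ε * (ε * a ^ 2 - 4 * t * b ^ 2) ^ 2 := by positivity
    linarith
  have h9 : (μ * b) ^ 4 ≤ t ^ 3 * b ^ 4 := by
    rw [mul_pow]
    gcongr
    exact (pow_le_pow_left₀ hμ hμt 4).trans (pow_le_pow_of_le_one ht.le ht1 (by norm_num))
  linarith

lemma norm_sum_smul_pow_four_le {N : ℕ} {a : Fin N → ℝ} (ha : ∀ l, 0 ≤ a l) (ha1 : ∑ l, a l = 1)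
    (y : Fin N → E) : ‖∑ l, a l • y l‖ ^ 4 ≤ ∑ l, a l * ‖y l‖ ^ 4 := by
  have h1 : ‖∑ l, a l • y l‖ ≤ ∑ l, a l * ‖y l‖ := by
    refine norm_sum_le_of_le _ fun l _ => ?_
    rw [norm_smul, Real.norm_of_nonneg (ha l)]
  exact (pow_le_pow_left₀ (norm_nonneg _) h1 4).trans
    (Real.pow_arith_mean_le_arith_mean_pow _ _ _ (fun l _ => ha l) ha1
      (fun l _ => norm_nonneg _) 4)

end FourthPower

section Integration

variable {Ω : Type*} {m mΩ : MeasurableSpace Ω} {P : Measure Ω}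

lemma memLp_four_iff {E : Type*} [NormedAddCommGroup E] {f : Ω → E}
    (hf : AEStronglyMeasurable f P) : MemLp f 4 P ↔ Integrable (fun ω => ‖f ω‖ ^ 4) P := by
  rw [← integrable_norm_rpow_iff hf (by norm_num) (by norm_num)]
  have h4 : (4 : ENNReal).toReal = ((4 : ℕ) : ℝ) := by norm_num
  simp_rw [h4, Real.rpow_natCast]

/-- The expectation of a bilinear expression in an `m`-measurable variable and a variable with zero
conditional mean given `m` vanishes. -/
lemma integral_bilin_eq_zero [IsProbabilityMeasure P] (hm : m ≤ mΩ)
    {E F K : Type*} [NormedAddCommGroup E] [NormedSpace ℝ E] [CompleteSpace E]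
    [NormedAddCommGroup F] [NormedSpace ℝ F] [NormedAddCommGroup K] [NormedSpace ℝ K]
    [CompleteSpace K] (B : F →L[ℝ] E →L[ℝ] K) {f : Ω → F} {g : Ω → E}
    (hf : StronglyMeasurable[m] f) (hfg : Integrable (fun ω => B (f ω) (g ω)) P)
    (hg : Integrable g P) (hg0 : P[g | m] =ᵐ[P] 0) : ∫ ω, B (f ω) (g ω) ∂P = 0 := by
  rw [← integral_condExp hm]
  refine integral_eq_zero_of_ae ?_
  filter_upwards [condExp_bilin_of_stronglyMeasurable_left B hf hfg hg, hg0] with ω h1 h2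
  rw [h1, h2]
  simp

lemma condExp_clm_eq_zero {E F : Type*} [NormedAddCommGroup E] [NormedSpace ℝ E]
    [CompleteSpace E] [NormedAddCommGroup F] [NormedSpace ℝ F] [CompleteSpace F] {g : Ω → E}
    (hg : Integrable g P) (hg0 : P[g | m] =ᵐ[P] 0) (T : E →L[ℝ] F) :
    P[fun ω => T (g ω) | m] =ᵐ[P] 0 := by
  filter_upwards [T.comp_condExp_comm hg (m := m), hg0] with ω h1 h2
  have h3 : T (P[g | m] ω) = (P[T ∘ g | m]) ω := h1
  rw [h2, Pi.zero_apply, map_zero] at h3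
  exact h3.symm

lemma integral_norm_sub_smul_pow_four_le [IsProbabilityMeasure P] (hm : m ≤ mΩ) {E : Type*}
    [NormedAddCommGroup E] [InnerProductSpace ℝ E] [CompleteSpace E] {x s : Ω → E}
    (hx : StronglyMeasurable[m] x) (hx4 : MemLp x 4 P) (hs4 : MemLp s 4 P)
    (hs0 : P[s | m] =ᵐ[P] 0) {μ t ε : ℝ} (hμ : 0 ≤ μ) (hμt : μ ≤ t) (ht : 0 < t)
    (ht1 : t ≤ 1) (hε : 0 < ε) :
    ∫ ω, ‖x ω - μ • s ω‖ ^ 4 ∂P ≤ (1 + ε * t) * ∫ ω, ‖x ω‖ ^ 4 ∂P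
      + (16 / ε + 3) * t ^ 3 * ∫ ω, ‖s ω‖ ^ 4 ∂P := by
  have hxi : Integrable (fun ω => ‖x ω‖ ^ 4) P := (memLp_four_iff hx4.1).1 hx4
  have hsi : Integrable (fun ω => ‖s ω‖ ^ 4) P := (memLp_four_iff hs4.1).1 hs4
  have hyi : Integrable (fun ω => ‖x ω - μ • s ω‖ ^ 4) P :=
    (memLp_four_iff (hx4.1.sub (hs4.1.const_smul μ))).1 (hx4.sub (hs4.const_smul μ))
  have hs1 : Integrable s P := hs4.integrable (by norm_num)
  have hYm : StronglyMeasurable[m] fun ω => ‖x ω‖ ^ 2 • x ω := (hx.norm.pow 2).smul hx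
  have hci : Integrable (fun ω => inner ℝ (‖x ω‖ ^ 2 • x ω) (s ω)) P := by
    refine (hxi.add hsi).mono' ((hYm.mono hm).aestronglyMeasurable.inner hs4.1)
      (ae_of_all _ fun ω => ?_)
    refine (norm_inner_le_norm _ _).trans ?_
    rw [norm_smul, norm_pow, norm_norm, Pi.add_apply]
    have ha := norm_nonneg (x ω)
    have hb := norm_nonneg (s ω)
    rcases le_total ‖x ω‖ ‖s ω‖ with h | h
    · calc ‖x ω‖ ^ 2 * ‖x ω‖ * ‖s ω‖ ≤ ‖s ω‖ ^ 2 * ‖s ω‖ * ‖s ω‖ := by gcongr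
        _ ≤ ‖x ω‖ ^ 4 + ‖s ω‖ ^ 4 := by nlinarith [pow_nonneg ha 4]
    · calc ‖x ω‖ ^ 2 * ‖x ω‖ * ‖s ω‖ ≤ ‖x ω‖ ^ 2 * ‖x ω‖ * ‖x ω‖ := by gcongr
        _ ≤ ‖x ω‖ ^ 4 + ‖s ω‖ ^ 4 := by nlinarith [pow_nonneg hb 4]
  have hc0 : ∫ ω, inner ℝ (‖x ω‖ ^ 2 • x ω) (s ω) ∂P = 0 :=
    integral_bilin_eq_zero hm (innerSL ℝ) hYm hci hs1 hs0
  calc ∫ ω, ‖x ω - μ • s ω‖ ^ 4 ∂P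
      ≤ ∫ ω, ((1 + ε * t) * ‖x ω‖ ^ 4 - 4 * μ * inner ℝ (‖x ω‖ ^ 2 • x ω) (s ω)
        + (16 / ε + 3) * t ^ 3 * ‖s ω‖ ^ 4) ∂P :=
      integral_mono hyi (((hxi.const_mul _).sub (hci.const_mul _)).add (hsi.const_mul _))
        fun ω => norm_sub_smul_pow_four_le _ _ hμ hμt ht ht1 hε
    _ = _ := by
      have h1 : Integrable (fun ω => (1 + ε * t) * ‖x ω‖ ^ 4
          - 4 * μ * inner ℝ (‖x ω‖ ^ 2 • x ω) (s ω)) P := (hxi.const_mul _).sub (hci.const_mul _)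
      rw [integral_add h1 (hsi.const_mul _), integral_sub (hxi.const_mul _) (hci.const_mul _),
        integral_const_mul, integral_const_mul, integral_const_mul, hc0]
      ring

section PiLp

variable {ι : Type*} {β : ι → Type*} [∀ i, NormedAddCommGroup (β i)] [∀ i, NormedSpace ℝ (β i)]

lemma stronglyMeasurable_piLp_apply {f : Ω → PiLp 2 β} (hf : StronglyMeasurable[m] f) (i : ι) :
    StronglyMeasurable[m] fun ω => f ω i :=
  (PiLp.proj (𝕜 := ℝ) 2 β i).continuous.comp_stronglyMeasurable hf

variable [Fintype ι]

lemma piLp_eq_sum_single [DecidableEq ι] (x : PiLp 2 β) :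
    x = ∑ i, (PiLp.continuousLinearEquiv 2 ℝ β).symm (ContinuousLinearMap.single ℝ β i (x i)) := by
  rw [← map_sum]
  ext j
  simp [Finset.sum_pi_single]

lemma stronglyMeasurable_piLp {f : Ω → PiLp 2 β} (hf : ∀ i, StronglyMeasurable[m] fun ω => f ω i) :
    StronglyMeasurable[m] f := by
  classical
  rw [show f = fun ω => ∑ i, (PiLp.continuousLinearEquiv 2 ℝ β).symm
    (ContinuousLinearMap.single ℝ β i (f ω i)) from funext fun ω => piLp_eq_sum_single (f ω)]
  refine Finset.stronglyMeasurable_fun_sum _ fun i _ => ?_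
  exact (((PiLp.continuousLinearEquiv 2 ℝ β).symm.continuous.comp
    (ContinuousLinearMap.single ℝ β i).continuous).comp_stronglyMeasurable (hf i))

lemma memLp_piLp {f : Ω → PiLp 2 β} {q : ENNReal} (hf : ∀ i, MemLp (fun ω => f ω i) q P) :
    MemLp f q P := by
  classical
  rw [show f = fun ω => ∑ i, (PiLp.continuousLinearEquiv 2 ℝ β).symm
    (ContinuousLinearMap.single ℝ β i (f ω i)) from funext fun ω => piLp_eq_sum_single (f ω)]
  refine memLp_finsetSum _ fun i _ => ?_
  exact ((PiLp.continuousLinearEquiv 2 ℝ β).symm.toContinuousLinearMap.comp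
    (ContinuousLinearMap.single ℝ β i)).comp_memLp' (hf i)

lemma memLp_piLp_apply {f : Ω → PiLp 2 β} {q : ENNReal} (hf : MemLp f q P) (i : ι) :
    MemLp (fun ω => f ω i) q P :=
  (PiLp.proj (𝕜 := ℝ) 2 β i).comp_memLp' hf

end PiLp

end Integration

section Moments

variable {N G M : ℕ} {Ω : Type*} {mΩ : MeasurableSpace Ω} {P : Measure Ω}
  {ℱ : Filtration ℕ mΩ} {net : Network N G} {A : Matrix (Fin N) (Fin N) ℝ}
  {J : Fin N → Vec M → ℝ} {wo : Fin N → Vec M}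
  {gradHat : Fin N → ℕ → Ω → Vec M → Vec M} {γ : ℝ}
  {Rs : Matrix (Fin N × Fin M) (Fin N × Fin M) ℝ}

lemma NoiseAssumption.memLp_noise (hs : NoiseAssumption P ℱ J wo gradHat γ Rs) {n : ℕ}
    {W : Ω → NetVec N M} (hW : StronglyMeasurable[ℱ n] W) (hW4 : MemLp W 4 P) :
    MemLp (noise J gradHat (n + 1) W) 4 P := by
  obtain ⟨α, σ, -, -, h⟩ := hs.fourth_moment
  exact (memLp_four_iff ((hs.adapted n W hW hW4).mono (ℱ.le _)).aestronglyMeasurable).2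
    (h n W hW hW4).1

lemma NoiseAssumption.exists_integral_noise_le [IsProbabilityMeasure P]
    (hs : NoiseAssumption P ℱ J wo gradHat γ Rs) :
    ∃ a ≥ 0, ∃ b ≥ 0, ∀ (n : ℕ) (W : Ω → NetVec N M), StronglyMeasurable[ℱ n] W → MemLp W 4 P →
      ∫ ω, ‖noise J gradHat (n + 1) W ω‖ ^ 4 ∂P ≤ a * ∫ ω, ‖netMin wo - W ω‖ ^ 4 ∂P + b := by
  obtain ⟨α, σ, -, -, h⟩ := hs.fourth_moment
  refine ⟨α ^ 2, by positivity, σ ^ 4, by positivity, fun n W hW hW4 => ?_⟩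
  have hd : MemLp (fun ω => netMin wo - W ω) 4 P := (memLp_const _).sub hW4
  have hi : Integrable (fun ω => ‖netMin wo - W ω‖ ^ 4) P := (memLp_four_iff hd.1).1 hd
  rw [← integral_condExp (ℱ.le n), ← integral_const_mul]
  calc _ ≤ ∫ ω, (α ^ 2 * ‖netMin wo - W ω‖ ^ 4 + σ ^ 4) ∂P :=
        integral_mono_ae integrable_condExp ((hi.const_mul _).add (integrable_const _))
          (h n W hW hW4).2
    _ = _ := by
      rw [integral_add (hi.const_mul _) (integrable_const _)]
      simp

lemma iterates_succ_sub (hA : IsCombination net A)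
    (hwo : ∀ k l, net.group k = net.group l → wo k = wo l) (μ : Fin N → ℝ)
    (W₀ : Ω → NetVec N M) (n : ℕ) (ω : Ω) (k : Fin N) :
    iterates net A gradHat μ W₀ (n + 1) ω k - wo k
      = ∑ l, A l k • ((iterates net A gradHat μ W₀ n ω l
          - μ l • gradient (J l) (iterates net A gradHat μ W₀ n ω l) - wo l)
        - μ l • noise J gradHat (n + 1) (iterates net A gradHat μ W₀ n) ω l) := by
  have h1 : iterates net A gradHat μ W₀ (n + 1) ω k
      = ∑ l ∈ net.groupNbhd k, A l k • (iterates net A gradHat μ W₀ n ω l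
        - μ l • gradHat l (n + 1) ω (iterates net A gradHat μ W₀ n ω l)) := rfl
  have h2 : wo k = ∑ l ∈ net.groupNbhd k, A l k • wo l := by
    rw [Finset.sum_congr rfl fun l hl => by rw [hwo l k (Network.mem_groupNbhd.1 hl).2],
      hA.sum_groupNbhd, ← Finset.sum_smul, hA.sum_one, one_smul]
  rw [h1, ← hA.sum_groupNbhd]
  conv_lhs => rw [h2]
  rw [← Finset.sum_sub_distrib]
  refine Finset.sum_congr rfl fun l _ => ?_
  rw [← smul_sub]
  congr 1
  simp only [noise, smul_sub]
  abel

lemma norm_netMin_sub_pow_four_le (w : NetVec N M) :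
    ‖netMin wo - w‖ ^ 4 ≤ N * ∑ k, ‖w k - wo k‖ ^ 4 := by
  have h1 : ‖netMin wo - w‖ ^ 2 = ∑ k, ‖w k - wo k‖ ^ 2 := by
    rw [PiLp.norm_sq_eq_of_L2]
    exact Finset.sum_congr rfl fun k _ => by rw [norm_sub_rev]; rfl
  have h2 := sq_sum_le_card_mul_sum_sq (s := Finset.univ) (f := fun k => ‖w k - wo k‖ ^ 2)
  simp only [Finset.card_univ, Fintype.card_fin, ← pow_mul] at h2
  calc ‖netMin wo - w‖ ^ 4 = (‖netMin wo - w‖ ^ 2) ^ 2 := by ring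
    _ ≤ _ := by rw [h1]; exact h2

section Regularity

variable {μ : Fin N → ℝ} {W₀ : Ω → NetVec N M}

/-- The deviation from the minimizers after an exact gradient step. -/
noncomputable def gradStepError (J : Fin N → Vec M → ℝ) (wo : Fin N → Vec M) (μ : Fin N → ℝ) (l : Fin N)
    (w : Vec M) : Vec M :=
  w - μ l • gradient (J l) w - wo l

lemma continuous_gradStepError (hJ : CostAssumption net J wo) (l : Fin N) : Continuous (gradStepError J wo μ l) := by
  have := (hJ.twice_differentiable l).continuous
  unfold gradStepError
  fun_prop

lemma memLp_gradStepError [IsProbabilityMeasure P] (hJ : CostAssumption net J wo)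
    (hstep : ∀ l w, ‖gradStepError J wo μ l w‖ ≤ ‖w - wo l‖)
    {W : Ω → NetVec N M} (hW4 : MemLp W 4 P) (l : Fin N) :
    MemLp (fun ω => gradStepError J wo μ l (W ω l)) 4 P := by
  have h1 : MemLp (fun ω => W ω l - wo l) 4 P := (memLp_piLp_apply hW4 l).sub (memLp_const _)
  exact h1.mono ((continuous_gradStepError hJ l).comp_aestronglyMeasurable
    (memLp_piLp_apply hW4 l).1) (ae_of_all _ fun ω => hstep l _)

lemma iterates_regular [IsProbabilityMeasure P] (hA : IsCombination net A) (hJ : CostAssumption net J wo)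
    (hs : NoiseAssumption P ℱ J wo gradHat γ Rs)
    (hstep : ∀ l w, ‖gradStepError J wo μ l w‖ ≤ ‖w - wo l‖)
    (hW₀ : StronglyMeasurable[ℱ 0] W₀) (hW₀4 : MemLp W₀ 4 P) (n : ℕ) :
    StronglyMeasurable[ℱ n] (iterates net A gradHat μ W₀ n) ∧
      MemLp (iterates net A gradHat μ W₀ n) 4 P := by
  induction n with
  | zero => exact ⟨hW₀, hW₀4⟩
  | succ n ih =>
    obtain ⟨hm, h4⟩ := ih
    have heq : ∀ k, (fun ω => iterates net A gradHat μ W₀ (n + 1) ω k)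
        = fun ω => (∑ l, A l k • (gradStepError J wo μ l (iterates net A gradHat μ W₀ n ω l)
          - μ l • noise J gradHat (n + 1) (iterates net A gradHat μ W₀ n) ω l)) + wo k := by
      intro k
      funext ω
      exact sub_eq_iff_eq_add.1 (iterates_succ_sub hA hJ.same_cluster μ W₀ n ω k)
    constructor
    · refine stronglyMeasurable_piLp fun k => ?_
      rw [heq k]
      refine (Finset.stronglyMeasurable_fun_sum _ fun l _ => ?_).add stronglyMeasurable_const
      have h1 := ((continuous_gradStepError (μ := μ) hJ l).comp_stronglyMeasurable
        (stronglyMeasurable_piLp_apply hm l)).mono (ℱ.mono n.le_succ)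
      have h2 := (stronglyMeasurable_piLp_apply (hs.adapted n _ hm h4) l).const_smul (μ l)
      exact (h1.sub h2).const_smul (A l k)
    · refine memLp_piLp fun k => ?_
      rw [heq k]
      refine (memLp_finsetSum _ fun l _ => ?_).add (memLp_const _)
      exact ((memLp_gradStepError hJ hstep h4 l).sub
        ((memLp_piLp_apply (hs.memLp_noise hm h4) l).const_smul (μ l))).const_smul (A l k)

/-- One step of the weighted fourth-moment recursion. -/
lemma sum_integral_iterates_succ_le [IsProbabilityMeasure P] (hA : IsCombination net A) (hJ : CostAssumption net J wo)
    (hs : NoiseAssumption P ℱ J wo gradHat γ Rs)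
    {lam : Fin N → ℝ} {t ε : ℝ}
    (ht : 0 < t) (ht1 : t ≤ 1) (hε : 0 < ε) (hlam : ∀ l, 0 ≤ t * lam l ∧ t * lam l ≤ 1)
    (hμ : ∀ l, 0 ≤ μ l ∧ μ l ≤ t)
    (hstep : ∀ l w, ‖gradStepError J wo μ l w‖ ≤ (1 - t * lam l) * ‖w - wo l‖)
    {q : Fin N → ℝ} (hq : ∀ l, 0 ≤ q l)
    {n : ℕ} (hm : StronglyMeasurable[ℱ n] (iterates net A gradHat μ W₀ n))
    (h4 : MemLp (iterates net A gradHat μ W₀ n) 4 P) :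
    ∑ k, q k * ∫ ω, ‖iterates net A gradHat μ W₀ (n + 1) ω k - wo k‖ ^ 4 ∂P
      ≤ ∑ l, (A *ᵥ q) l * ((1 + ε * t) * ((1 - t * lam l)
          * ∫ ω, ‖iterates net A gradHat μ W₀ n ω l - wo l‖ ^ 4 ∂P)
        + (16 / ε + 3) * t ^ 3
          * ∫ ω, ‖noise J gradHat (n + 1) (iterates net A gradHat μ W₀ n) ω‖ ^ 4 ∂P) := by
  set W := iterates net A gradHat μ W₀ n with hWdef
  set s := noise J gradHat (n + 1) W with hsdef
  have hstep' : ∀ l w, ‖gradStepError J wo μ l w‖ ≤ ‖w - wo l‖ := fun l w =>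
    (hstep l w).trans (mul_le_of_le_one_left (norm_nonneg _) (by linarith [(hlam l).1]))
  have hs4 := hs.memLp_noise hm h4
  have hx4 := memLp_gradStepError hJ hstep' h4
  have hsl4 := fun l => memLp_piLp_apply hs4 l
  have hsi : Integrable (fun ω => ‖s ω‖ ^ 4) P := (memLp_four_iff hs4.1).1 hs4
  have hyl : ∀ l, MemLp (fun ω => gradStepError J wo μ l (W ω l) - μ l • s ω l) 4 P := fun l =>
    (hx4 l).sub ((hsl4 l).const_smul (μ l))
  have hyi : ∀ l, Integrable (fun ω => ‖gradStepError J wo μ l (W ω l) - μ l • s ω l‖ ^ 4) P :=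
    fun l => (memLp_four_iff (hyl l).1).1 (hyl l)
  have hei : ∀ l, Integrable (fun ω => ‖W ω l - wo l‖ ^ 4) P := fun l => by
    have h : MemLp (fun ω => W ω l - wo l) 4 P := (memLp_piLp_apply h4 l).sub (memLp_const _)
    exact (memLp_four_iff h.1).1 h
  have hcomb : ∀ k, ∫ ω, ‖iterates net A gradHat μ W₀ (n + 1) ω k - wo k‖ ^ 4 ∂P
      ≤ ∑ l, A l k * ∫ ω, ‖gradStepError J wo μ l (W ω l) - μ l • s ω l‖ ^ 4 ∂P := by
    intro k
    simp_rw [← integral_const_mul]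
    rw [← integral_finsetSum _ fun l _ => (hyi l).const_mul _]
    refine integral_mono_of_nonneg (ae_of_all _ fun ω => by positivity)
      (integrable_finsetSum _ fun l _ => (hyi l).const_mul _) (ae_of_all _ fun ω => ?_)
    simp only
    rw [iterates_succ_sub (J := J) hA hJ.same_cluster μ W₀ n ω k]
    exact norm_sum_smul_pow_four_le (fun l => hA.nonneg l k) (hA.sum_one k) _
  have hsingle : ∀ l, ∫ ω, ‖gradStepError J wo μ l (W ω l) - μ l • s ω l‖ ^ 4 ∂P
      ≤ (1 + ε * t) * ((1 - t * lam l) * ∫ ω, ‖W ω l - wo l‖ ^ 4 ∂P)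
        + (16 / ε + 3) * t ^ 3 * ∫ ω, ‖s ω‖ ^ 4 ∂P := by
    intro l
    have hs0 := condExp_clm_eq_zero (hs4.integrable (by norm_num)) (hs.martingale_diff n W hm h4)
      (PiLp.proj (𝕜 := ℝ) 2 (fun _ : Fin N => Vec M) l)
    refine (integral_norm_sub_smul_pow_four_le (ℱ.le n)
      ((continuous_gradStepError hJ l).comp_stronglyMeasurable
        (stronglyMeasurable_piLp_apply hm l)) (hx4 l) (hsl4 l) hs0 (hμ l).1 (hμ l).2 ht ht1
      hε).trans ?_
    have h1 : ∫ ω, ‖gradStepError J wo μ l (W ω l)‖ ^ 4 ∂P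
        ≤ (1 - t * lam l) * ∫ ω, ‖W ω l - wo l‖ ^ 4 ∂P := by
      rw [← integral_const_mul]
      refine integral_mono_of_nonneg (ae_of_all _ fun ω => by positivity)
        ((hei l).const_mul _) (ae_of_all _ fun ω => ?_)
      have h0 : 0 ≤ 1 - t * lam l := by linarith [(hlam l).2]
      calc ‖gradStepError J wo μ l (W ω l)‖ ^ 4 ≤ ((1 - t * lam l) * ‖W ω l - wo l‖) ^ 4 :=
            pow_le_pow_left₀ (norm_nonneg _) (hstep l _) 4
        _ = (1 - t * lam l) ^ 4 * ‖W ω l - wo l‖ ^ 4 := mul_pow _ _ _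
        _ ≤ _ := mul_le_mul_of_nonneg_right
          (pow_le_of_le_one h0 (by linarith [(hlam l).1]) (by norm_num)) (by positivity)
    have h2 : ∫ ω, ‖s ω l‖ ^ 4 ∂P ≤ ∫ ω, ‖s ω‖ ^ 4 ∂P :=
      integral_mono_of_nonneg (ae_of_all _ fun ω => by positivity) hsi
        (ae_of_all _ fun ω => pow_le_pow_left₀ (norm_nonneg _) (PiLp.norm_apply_le (s ω) l) 4)
    exact add_le_add (mul_le_mul_of_nonneg_left h1 (by positivity))
      (mul_le_mul_of_nonneg_left h2 (by positivity))
  have hAq : ∀ l, 0 ≤ (A *ᵥ q) l := by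
    intro l
    simp only [Matrix.mulVec, dotProduct]
    exact Finset.sum_nonneg fun k _ => mul_nonneg (hA.nonneg l k) (hq k)
  calc ∑ k, q k * ∫ ω, ‖iterates net A gradHat μ W₀ (n + 1) ω k - wo k‖ ^ 4 ∂P
      ≤ ∑ k, q k * ∑ l, A l k
          * ∫ ω, ‖gradStepError J wo μ l (W ω l) - μ l • s ω l‖ ^ 4 ∂P :=
        Finset.sum_le_sum fun k _ => mul_le_mul_of_nonneg_left (hcomb k) (hq k)
    _ = ∑ l, (A *ᵥ q) l * ∫ ω, ‖gradStepError J wo μ l (W ω l) - μ l • s ω l‖ ^ 4 ∂P := by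
        simp only [Matrix.mulVec, dotProduct, Finset.mul_sum, Finset.sum_mul]
        rw [Finset.sum_comm]
        exact Finset.sum_congr rfl fun l _ => Finset.sum_congr rfl fun k _ => by ring
    _ ≤ _ := Finset.sum_le_sum fun l _ => mul_le_mul_of_nonneg_left (hsingle l) (hAq l)

end Regularity

end Moments

lemma eventually_lt_nhdsGT_zero {f : ℝ → ℝ} {c : ℝ} (hf : Continuous f) (h0 : f 0 < c) :
    ∀ᶠ t in 𝓝[>] (0 : ℝ), f t < c :=
  nhdsWithin_le_nhds (hf.continuousAt.eventually_lt_const h0)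

section Stability

variable {N G M : ℕ} {Ω : Type*} {mΩ : MeasurableSpace Ω} {P : Measure Ω}
  {ℱ : Filtration ℕ mΩ} {net : Network N G} {A : Matrix (Fin N) (Fin N) ℝ}
  {J : Fin N → Vec M → ℝ} {wo : Fin N → Vec M}
  {gradHat : Fin N → ℕ → Ω → Vec M → Vec M} {γ : ℝ}
  {Rs : Matrix (Fin N × Fin M) (Fin N × Fin M) ℝ}

/-- Fourth-order stability of the diffusion iterates: for small step-sizes of comparable magnitude
`t` the iterates keep finite fourth moments, and their deviation from the minimizers is eventually
of order `t ^ 2` in the fourth moment. -/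
theorem exists_fourth_moment_bound [IsProbabilityMeasure P] (hA : IsCombination net A)
    {p : Fin N → ℝ} (hp : IsPerron net A p) (hJ : CostAssumption net J wo)
    (hs : NoiseAssumption P ℱ J wo gradHat γ Rs) {τ : ℝ} (hτ : 0 < τ) :
    ∃ K : ℝ, 0 ≤ K ∧ ∀ᶠ t in 𝓝[>] (0 : ℝ), ∀ μ : Fin N → ℝ, (∀ k, τ * t ≤ μ k) →
      (∀ k, μ k ≤ t) → ∀ W₀ : Ω → NetVec N M, StronglyMeasurable[ℱ 0] W₀ → MemLp W₀ 4 P →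
        (∀ n, StronglyMeasurable[ℱ n] (iterates net A gradHat μ W₀ n) ∧
          MemLp (iterates net A gradHat μ W₀ n) 4 P) ∧
        ∀ᶠ n in atTop, ∫ ω, ‖netMin wo - iterates net A gradHat μ W₀ n ω‖ ^ 4 ∂P ≤ K * t ^ 2 := by
  obtain ⟨lamL, lamU, hlam0, hL, hU, hgroup⟩ := hJ.hess_bounds
  obtain ⟨δ, hδ, qlo, hqlo, qhi, hweights⟩ := hp.exists_contracting_weights hA
    (lam := fun k => τ * lamL k) (fun k => mul_nonneg hτ.le (hlam0 k).1) (fun m => by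
      obtain ⟨k, hk, hk0⟩ := hgroup m
      exact ⟨k, hk, mul_pos hτ hk0⟩)
  obtain ⟨a, ha, b, hb, hnoise⟩ := hs.exists_integral_noise_le
  set Q : ℝ := N * |qhi| with hQ
  set c : ℝ := 16 / (δ / 2) + 3 with hc
  set B : ℝ := Q * c * b + 1 with hB
  have hQ0 : 0 ≤ Q := by positivity
  have hc0 : 0 < c := by positivity
  have hB0 : 0 < B := by positivity
  refine ⟨N / qlo * (8 * B / δ), by positivity, ?_⟩
  have e1 : ∀ᶠ t in 𝓝[>] (0 : ℝ), t < 1 := eventually_lt_nhdsGT_zero continuous_id one_pos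
  have e2 : ∀ᶠ t in 𝓝[>] (0 : ℝ), δ * t < 1 :=
    eventually_lt_nhdsGT_zero (by fun_prop) (by simp)
  have e3 : ∀ᶠ t in 𝓝[>] (0 : ℝ), ∀ l, t * lamU l < 1 :=
    eventually_all.2 fun l => eventually_lt_nhdsGT_zero (by fun_prop) (by simp)
  have e4 : ∀ᶠ t in 𝓝[>] (0 : ℝ), ∀ l, t * (τ * lamL l) < 1 :=
    eventually_all.2 fun l => eventually_lt_nhdsGT_zero (by fun_prop) (by simp)
  have e5 : ∀ᶠ t in 𝓝[>] (0 : ℝ), Q * c * (a * (N / qlo)) * t ^ 2 < δ / 4 :=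
    eventually_lt_nhdsGT_zero (by fun_prop) (by simpa using hδ)
  filter_upwards [hweights, e1, e2, e3, e4, e5, self_mem_nhdsWithin] with t hq e1 e2 e3 e4 e5
    (ht : 0 < t) μ hμ hμt W₀ hW₀ hW₀4
  obtain ⟨q, hqb, hqc⟩ := hq
  have hμ0 : ∀ l, 0 ≤ μ l := fun l => (mul_pos hτ ht).le.trans (hμ l)
  have hlam : ∀ l, 0 ≤ t * (τ * lamL l) ∧ t * (τ * lamL l) ≤ 1 := fun l =>
    ⟨mul_nonneg ht.le (mul_nonneg hτ.le (hlam0 l).1), (e4 l).le⟩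
  have hstep : ∀ l w, ‖gradStepError J wo μ l w‖ ≤ (1 - t * (τ * lamL l)) * ‖w - wo l‖ := by
    intro l w
    have hU0 : 0 ≤ lamU l := (hlam0 l).1.trans (hlam0 l).2
    have h := norm_gradient_step_sub_le (hJ.twice_differentiable l) (hL l) (hU l) (hlam0 l).2
      (hμ0 l) ((mul_le_mul_of_nonneg_right (hμt l) hU0).trans_lt (e3 l)) w (wo l)
    rw [gradient_eq_zero_of_isMinOn (hJ.minimizer l), smul_zero, sub_zero] at h
    refine h.trans (mul_le_mul_of_nonneg_right ?_ (norm_nonneg _))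
    have := mul_le_mul_of_nonneg_right (hμ l) (hlam0 l).1
    linarith
  have hstep' : ∀ l w, ‖gradStepError J wo μ l w‖ ≤ ‖w - wo l‖ := fun l w =>
    (hstep l w).trans (mul_le_of_le_one_left (norm_nonneg _) (by linarith [(hlam l).1]))
  have hreg := iterates_regular hA hJ hs hstep' hW₀ hW₀4
  refine ⟨hreg, ?_⟩
  set e : ℕ → Fin N → ℝ := fun n k =>
    ∫ ω, ‖iterates net A gradHat μ W₀ n ω k - wo k‖ ^ 4 ∂P with he
  have he0 : ∀ n k, 0 ≤ e n k := fun n k => integral_nonneg fun ω => by positivity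
  have hei : ∀ n k, Integrable (fun ω => ‖iterates net A gradHat μ W₀ n ω k - wo k‖ ^ 4) P := by
    intro n k
    have h : MemLp (fun ω => iterates net A gradHat μ W₀ n ω k - wo k) 4 P :=
      (memLp_piLp_apply (hreg n).2 k).sub (memLp_const _)
    exact (memLp_four_iff h.1).1 h
  set V : ℕ → ℝ := fun n => ∑ k, q k * e n k with hV
  have hV0 : ∀ n, 0 ≤ V n := fun n => Finset.sum_nonneg fun k _ =>
    mul_nonneg (hqlo.le.trans (hqb k).1) (he0 n k)
  have hEV : ∀ n, ∫ ω, ‖netMin wo - iterates net A gradHat μ W₀ n ω‖ ^ 4 ∂P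
      ≤ N / qlo * V n := by
    intro n
    calc _ ≤ ∫ ω, N * ∑ k, ‖iterates net A gradHat μ W₀ n ω k - wo k‖ ^ 4 ∂P :=
          integral_mono_of_nonneg (ae_of_all _ fun ω => by positivity)
            ((integrable_finsetSum _ fun k _ => hei n k).const_mul _)
            (ae_of_all _ fun ω => norm_netMin_sub_pow_four_le _)
      _ = N * ∑ k, e n k := by
          rw [integral_const_mul, integral_finsetSum _ fun k _ => hei n k]
      _ = N / qlo * ∑ k, qlo * e n k := by rw [← Finset.mul_sum]; field_simp
      _ ≤ N / qlo * V n := mul_le_mul_of_nonneg_left (Finset.sum_le_sum fun k _ =>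
          mul_le_mul_of_nonneg_right (hqb k).1 (he0 n k)) (by positivity)
  have hAq0 : ∀ l, 0 ≤ (A *ᵥ q) l := by
    intro l
    simp only [Matrix.mulVec, dotProduct]
    exact Finset.sum_nonneg fun k _ => mul_nonneg (hA.nonneg l k) (hqlo.le.trans (hqb k).1)
  have hAqQ : ∑ l, (A *ᵥ q) l ≤ Q := by
    rw [hA.sum_mulVec]
    calc ∑ k, q k ≤ ∑ _k : Fin N, |qhi| :=
          Finset.sum_le_sum fun k _ => (hqb k).2.trans (le_abs_self _)
      _ = Q := by simp [hQ]
  have hrec : ∀ n, V (n + 1) ≤ (1 - δ * t / 4) * V n + B * t ^ 3 := by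
    intro n
    set S := ∫ ω, ‖noise J gradHat (n + 1) (iterates net A gradHat μ W₀ n) ω‖ ^ 4 ∂P with hS
    have hS0 : 0 ≤ S := integral_nonneg fun ω => by positivity
    have hSle : S ≤ a * (N / qlo * V n) + b :=
      (hnoise n _ (hreg n).1 (hreg n).2).trans
        (add_le_add_left (mul_le_mul_of_nonneg_left (hEV n) ha) b)
    have h1 := sum_integral_iterates_succ_le (ε := δ / 2) (W₀ := W₀) hA hJ hs ht e1.le
      (by positivity) hlam (fun l => ⟨hμ0 l, hμt l⟩) hstep (fun l => hqlo.le.trans (hqb l).1)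
      (hreg n).1 (hreg n).2
    have h2 : ∀ l, (A *ᵥ q) l * ((1 + δ / 2 * t) * ((1 - t * (τ * lamL l)) * e n l)
        + c * t ^ 3 * S) ≤ (1 - δ * t / 2) * (q l * e n l) + (A *ᵥ q) l * (c * t ^ 3 * S) := by
      intro l
      have h3 := mul_le_mul_of_nonneg_right (hqc l) (he0 n l)
      have h4 : 0 ≤ q l * e n l := mul_nonneg (hqlo.le.trans (hqb l).1) (he0 n l)
      have h5 : (1 + δ / 2 * t) * ((A *ᵥ q) l * (1 - t * (τ * lamL l)) * e n l)
          ≤ (1 + δ / 2 * t) * ((1 - δ * t) * q l * e n l) :=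
        mul_le_mul_of_nonneg_left h3 (by positivity)
      have h6 : 0 ≤ (δ * t) ^ 2 / 2 * (q l * e n l) := by positivity
      nlinarith
    have h7 : V (n + 1) ≤ (1 - δ * t / 2) * V n + Q * (c * t ^ 3 * S) := by
      refine (h1.trans (Finset.sum_le_sum fun l _ => h2 l)).trans ?_
      rw [Finset.sum_add_distrib, ← Finset.mul_sum, ← Finset.sum_mul]
      gcongr
    have h8 : Q * (c * t ^ 3 * S) ≤ Q * (c * t ^ 3 * (a * (N / qlo * V n) + b)) := by gcongr
    have h9 : Q * c * (a * (N / qlo)) * t ^ 2 * (t * V n) ≤ δ / 4 * (t * V n) :=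
      mul_le_mul_of_nonneg_right e5.le (mul_nonneg ht.le (hV0 n))
    have h10 : B * t ^ 3 = Q * c * b * t ^ 3 + t ^ 3 := by rw [hB]; ring
    have h11 : 0 < t ^ 3 := by positivity
    nlinarith
  have hδt : 0 < δ * t := mul_pos hδ ht
  have hev := eventually_le_of_recursion (a := V) (ρ := 1 - δ * t / 4) (b := B * t ^ 3)
    (by linarith) (by linarith) (by positivity) (Eventually.of_forall hrec)
  filter_upwards [hev] with n hn
  refine (hEV n).trans ?_
  rw [mul_assoc]
  refine mul_le_mul_of_nonneg_left (hn.trans (le_of_eq ?_)) (by positivity)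
  have : 1 - (1 - δ * t / 4) = δ * t / 4 := by ring
  rw [this]
  field_simp
  ring

end Stability

lemma rpow_le_mul_one_add_pow_four {r t γ : ℝ} (hr : 0 ≤ r) (ht : 0 < t) (hγ : 0 < γ)
    (hγ4 : γ ≤ 4) : r ^ γ ≤ t ^ (γ / 2) * (1 + r ^ 4 / t ^ 2) := by
  set u : ℝ := r ^ 2 / t with hu
  have hu0 : 0 ≤ u := by positivity
  have h1 : r ^ γ = t ^ (γ / 2) * u ^ (γ / 2) := by
    rw [← Real.mul_rpow ht.le hu0, hu, mul_div_cancel₀ _ ht.ne', ← Real.rpow_natCast,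
      ← Real.rpow_mul hr]
    congr 1
    push_cast
    ring
  have h2 : r ^ 4 / t ^ 2 = u ^ 2 := by rw [hu]; ring
  rw [h1, h2]
  refine mul_le_mul_of_nonneg_left ?_ (by positivity)
  rcases le_total u 1 with h | h
  · linarith [Real.rpow_le_one hu0 h (by positivity : 0 ≤ γ / 2), sq_nonneg u]
  · have h3 : u ^ (γ / 2) ≤ u ^ (2 : ℝ) := Real.rpow_le_rpow_of_exponent_le h (by linarith)
    rw [Real.rpow_two] at h3
    linarith

section Covariance

variable {N G M : ℕ} {Ω : Type*} {mΩ : MeasurableSpace Ω} {P : Measure Ω}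
  {ℱ : Filtration ℕ mΩ} {J : Fin N → Vec M → ℝ} {wo : Fin N → Vec M}
  {gradHat : Fin N → ℕ → Ω → Vec M → Vec M} {γ : ℝ}
  {Rs : Matrix (Fin N × Fin M) (Fin N × Fin M) ℝ}

/-- The unconditional covariance of the network gradient noise at time `n + 1`. -/
noncomputable def noiseCov (P : Measure Ω) (J : Fin N → Vec M → ℝ)
    (gradHat : Fin N → ℕ → Ω → Vec M → Vec M) (n : ℕ) (W : Ω → NetVec N M) :
    Matrix (Fin N × Fin M) (Fin N × Fin M) ℝ :=
  Matrix.of fun x y =>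
    ∫ ω, noise J gradHat (n + 1) W ω x.1 x.2 * noise J gradHat (n + 1) W ω y.1 y.2 ∂P

lemma integrable_condCov (n : ℕ) (W : Ω → NetVec N M) (x y : Fin N × Fin M) :
    Integrable (fun ω => condCov P ℱ J gradHat n W ω x y) P :=
  integrable_condExp

lemma integral_condCov [IsProbabilityMeasure P] (n : ℕ) (W : Ω → NetVec N M)
    (x y : Fin N × Fin M) :
    ∫ ω, condCov P ℱ J gradHat n W ω x y ∂P = noiseCov P J gradHat n W x y :=
  integral_condExp (ℱ.le n)

lemma abs_apply_apply_le_norm (s : NetVec N M) (x : Fin N × Fin M) : |s x.1 x.2| ≤ ‖s‖ :=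
  (PiLp.norm_apply_le (s x.1) x.2).trans (PiLp.norm_apply_le s x.1)

lemma MemLp.integrable_apply_mul_apply [IsProbabilityMeasure P] {s : Ω → NetVec N M}
    (hs : MemLp s 4 P) (x y : Fin N × Fin M) :
    Integrable (fun ω => s ω x.1 x.2 * s ω y.1 y.2) P := by
  have h : ∀ z : Fin N × Fin M, MemLp (fun ω => s ω z.1 z.2) 2 P := fun z =>
    (memLp_piLp_apply (memLp_piLp_apply hs z.1) z.2).mono_exponent (by norm_num)
  exact (h x).integrable_mul (h y)

lemma NoiseAssumption.tendsto_noiseCov_netMin [IsProbabilityMeasure P]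
    (hs : NoiseAssumption P ℱ J wo gradHat γ Rs) (x y : Fin N × Fin M) :
    Tendsto (fun n => noiseCov P J gradHat n (fun _ => netMin wo) x y) atTop (𝓝 (Rs x y)) := by
  obtain ⟨α, σ, -, -, h4⟩ := hs.fourth_moment
  have hm : ∀ n, StronglyMeasurable[ℱ n] fun _ : Ω => netMin wo := fun n =>
    stronglyMeasurable_const
  have hmem : MemLp (fun _ : Ω => netMin wo) 4 P := memLp_const _
  have hbound : ∀ n, ∀ᵐ ω ∂P,
      ‖condCov P ℱ J gradHat n (fun _ => netMin wo) ω x y‖ ≤ 1 + σ ^ 4 := by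
    intro n
    have hn4 := hs.memLp_noise (hm n) hmem
    set s := noise J gradHat (n + 1) fun _ => netMin wo with hsdef
    have hi := MemLp.integrable_apply_mul_apply hn4 x y
    have hsi : Integrable (fun ω => ‖s ω‖ ^ 4) P := (h4 n _ (hm n) hmem).1
    have h1i : Integrable (fun ω => 1 + ‖s ω‖ ^ 4) P := (integrable_const 1).add hsi
    have hle : ∀ ω, |s ω x.1 x.2 * s ω y.1 y.2| ≤ 1 + ‖s ω‖ ^ 4 := by
      intro ω
      rw [abs_mul]
      have h1 := mul_le_mul (abs_apply_apply_le_norm (s ω) x) (abs_apply_apply_le_norm (s ω) y)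
        (abs_nonneg _) (norm_nonneg _)
      nlinarith [sq_nonneg (‖s ω‖ ^ 2 - 1)]
    have hup := condExp_mono (m := ℱ n) hi h1i
      (ae_of_all _ fun ω => (le_abs_self _).trans (hle ω))
    have hlo := condExp_mono (m := ℱ n) h1i.neg hi
      (ae_of_all _ fun ω => (abs_le.1 (hle ω)).1)
    have hneg := condExp_neg (μ := P) (fun ω => 1 + ‖s ω‖ ^ 4) (ℱ n)
    have hadd := condExp_add (integrable_const (1 : ℝ)) hsi (ℱ n)
    have hconst := condExp_const (μ := P) (ℱ.le n) (1 : ℝ)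
    filter_upwards [hup, hlo, hneg, hadd, (h4 n _ (hm n) hmem).2] with ω h1 h2 h3 h5 h6
    have h7 : (P[fun ω => 1 + ‖s ω‖ ^ 4 | ℱ n]) ω = 1 + (P[fun ω => ‖s ω‖ ^ 4 | ℱ n]) ω := by
      refine Eq.trans h5 ?_
      rw [Pi.add_apply, hconst]
    rw [sub_self, norm_zero] at h6
    have h8 : (P[fun ω => 1 + ‖s ω‖ ^ 4 | ℱ n]) ω ≤ 1 + σ ^ 4 := by
      rw [h7]; linarith
    have h9 : -(P[fun ω => 1 + ‖s ω‖ ^ 4 | ℱ n]) ω ≤ condCov P ℱ J gradHat n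
        (fun _ => netMin wo) ω x y := h3.symm.le.trans h2
    have h10 : condCov P ℱ J gradHat n (fun _ => netMin wo) ω x y
        ≤ (P[fun ω => 1 + ‖s ω‖ ^ 4 | ℱ n]) ω := h1
    rw [Real.norm_eq_abs, abs_le]
    constructor <;> linarith
  have hlim : ∀ᵐ ω ∂P, Tendsto
      (fun n => condCov P ℱ J gradHat n (fun _ => netMin wo) ω x y) atTop (𝓝 (Rs x y)) := by
    filter_upwards [hs.cov_limit] with ω hω
    rw [tendsto_iff_norm_sub_tendsto_zero]
    exact squeeze_zero (fun _ => norm_nonneg _) (fun n => abs_entry_le_l2_opNorm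
      (condCov P ℱ J gradHat n (fun _ => netMin wo) ω - Rs) x y) hω
  have := tendsto_integral_of_dominated_convergence (μ := P) (fun _ => 1 + σ ^ 4)
    (fun n => (integrable_condCov n _ x y).1) (integrable_const _) hbound hlim
  simpa [integral_condCov] using this

/-- The covariance of the gradient noise along iterates with fourth-order deviations `K t ^ 2` is
eventually within order `t ^ (γ / 2)` of its limit. -/
lemma NoiseAssumption.exists_norm_noiseCov_sub_le [IsProbabilityMeasure P]
    (hs : NoiseAssumption P ℱ J wo gradHat γ Rs) {K : ℝ} (hK : 0 ≤ K) :
    ∃ C : ℝ, 0 ≤ C ∧ ∀ t > 0, ∀ W : ℕ → Ω → NetVec N M,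
      (∀ n, StronglyMeasurable[ℱ n] (W n) ∧ MemLp (W n) 4 P) →
      (∀ᶠ n in atTop, ∫ ω, ‖netMin wo - W n ω‖ ^ 4 ∂P ≤ K * t ^ 2) →
      ∀ᶠ n in atTop, ‖noiseCov P J gradHat n (W n) - Rs‖ ≤ C * t ^ (γ / 2) := by
  obtain ⟨κ, hκ, hlip⟩ := hs.cov_lipschitz
  refine ⟨Fintype.card (Fin N × Fin M) * Fintype.card (Fin N × Fin M) * (κ * (1 + K) + 1),
    by positivity, fun t ht W hW hWK => ?_⟩
  have hθ : 0 < t ^ (γ / 2) := by positivity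
  have hclose : ∀ᶠ n in atTop, ∀ x y,
      |noiseCov P J gradHat n (fun _ => netMin wo) x y - Rs x y| < t ^ (γ / 2) :=
    eventually_all.2 fun x => eventually_all.2 fun y =>
      (Metric.tendsto_nhds.1 (hs.tendsto_noiseCov_netMin x y)) _ hθ
  filter_upwards [hclose, hWK] with n h1 h2
  rw [mul_assoc]
  refine l2_opNorm_le_of_entries fun x y => ?_
  have hd : MemLp (fun ω => netMin wo - W n ω) 4 P := (memLp_const _).sub (hW n).2
  have hdi : Integrable (fun ω => ‖netMin wo - W n ω‖ ^ 4) P := (memLp_four_iff hd.1).1 hd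
  have hgi : Integrable (fun ω => κ * (t ^ (γ / 2) * (1 + ‖netMin wo - W n ω‖ ^ 4 / t ^ 2))) P :=
    (((integrable_const 1).add (hdi.div_const _)).const_mul _).const_mul _
  have h3 : |noiseCov P J gradHat n (fun _ => netMin wo) x y - noiseCov P J gradHat n (W n) x y|
      ≤ κ * (1 + K) * t ^ (γ / 2) := by
    rw [← integral_condCov (ℱ := ℱ), ← integral_condCov (ℱ := ℱ),
      ← integral_sub (integrable_condCov _ _ x y) (integrable_condCov _ _ x y), ← Real.norm_eq_abs]
    calc _ ≤ ∫ ω, κ * (t ^ (γ / 2) * (1 + ‖netMin wo - W n ω‖ ^ 4 / t ^ 2)) ∂P := by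
          refine norm_integral_le_of_norm_le hgi ?_
          filter_upwards [hlip n (W n) (hW n).1 (hW n).2] with ω hω
          refine (abs_entry_le_l2_opNorm (condCov P ℱ J gradHat n (fun _ => netMin wo) ω
            - condCov P ℱ J gradHat n (W n) ω) x y).trans (hω.trans ?_)
          exact mul_le_mul_of_nonneg_left (rpow_le_mul_one_add_pow_four (norm_nonneg _) ht
            hs.cov_exponent.1 hs.cov_exponent.2) hκ
      _ = κ * (t ^ (γ / 2) * (1 + (∫ ω, ‖netMin wo - W n ω‖ ^ 4 ∂P) / t ^ 2)) := by
          rw [integral_const_mul, integral_const_mul,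
            integral_add (integrable_const _) (hdi.div_const _), integral_div]
          simp
      _ ≤ κ * (t ^ (γ / 2) * (1 + K)) := by
          gcongr
          rwa [div_le_iff₀ (by positivity)]
      _ = _ := by ring
  have h4 := h1 x y
  rw [Matrix.sub_apply]
  rw [abs_lt] at h4
  rw [abs_le] at h3 ⊢
  constructor <;> linarith

end Covariance

section SecondMoment

variable {Ω : Type*} {mΩ : MeasurableSpace Ω} {P : Measure Ω} {ι κ : Type*} [Fintype ι]
  [Fintype κ]

lemma integral_dotProduct_mul_dotProduct {u : ι → Ω → ℝ} {v : κ → Ω → ℝ}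
    (huv : ∀ i j, Integrable (fun ω => u i ω * v j ω) P) (a : ι → ℝ) (b : κ → ℝ) :
    Integrable (fun ω => (∑ i, a i * u i ω) * ∑ j, b j * v j ω) P ∧
    ∫ ω, (∑ i, a i * u i ω) * ∑ j, b j * v j ω ∂P
      = ∑ i, ∑ j, a i * b j * ∫ ω, u i ω * v j ω ∂P := by
  have h1 : (fun ω => (∑ i, a i * u i ω) * ∑ j, b j * v j ω)
      = fun ω => ∑ i, ∑ j, a i * b j * (u i ω * v j ω) := by
    funext ω
    rw [Finset.sum_mul_sum]
    exact Finset.sum_congr rfl fun i _ => Finset.sum_congr rfl fun j _ => by ring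
  have h2 : ∀ i, Integrable (fun ω => ∑ j, a i * b j * (u i ω * v j ω)) P := fun i =>
    integrable_finsetSum _ fun j _ => (huv i j).const_mul _
  rw [h1]
  refine ⟨integrable_finsetSum _ fun i _ => h2 i, ?_⟩
  rw [integral_finsetSum _ fun i _ => h2 i]
  refine Finset.sum_congr rfl fun i _ => ?_
  rw [integral_finsetSum _ fun j _ => (huv i j).const_mul _]
  exact Finset.sum_congr rfl fun j _ => integral_const_mul _ _

lemma mul_of_mul_transpose_apply {n : Type*} (E : Matrix n ι ℝ) (X : ι → ι → ℝ) (r c : n) :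
    (E * (Matrix.of X) * Eᵀ) r c = ∑ i, ∑ j, E r i * E c j * X i j := by
  simp only [Matrix.mul_apply, Matrix.of_apply, Matrix.transpose_apply, Finset.sum_mul]
  rw [Finset.sum_comm]
  exact Finset.sum_congr rfl fun i _ => Finset.sum_congr rfl fun j _ => by ring

/-- Second moments of a linear combination of two uncorrelated random vectors. -/
lemma integral_linear_comb_mul {u : ι → Ω → ℝ} {v : κ → Ω → ℝ} (hu : ∀ i, MemLp (u i) 2 P)
    (hv : ∀ j, MemLp (v j) 2 P) (huv : ∀ i j, ∫ ω, u i ω * v j ω ∂P = 0)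
    {n : Type*} (D : Matrix n ι ℝ) (B : Matrix n κ ℝ) (r c : n) :
    ∫ ω, ((D *ᵥ fun i => u i ω) + B *ᵥ fun j => v j ω) r
        * ((D *ᵥ fun i => u i ω) + B *ᵥ fun j => v j ω) c ∂P
      = (D * (Matrix.of fun i j => ∫ ω, u i ω * u j ω ∂P) * Dᵀ
        + B * (Matrix.of fun i j => ∫ ω, v i ω * v j ω ∂P) * Bᵀ) r c := by
  have hvu : ∀ j i, ∫ ω, v j ω * u i ω ∂P = 0 := fun j i => by
    simp_rw [mul_comm (v j _)]; exact huv i j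
  have i1 := integral_dotProduct_mul_dotProduct (P := P) (u := u) (v := u)
    (fun i j => (hu i).integrable_mul (hu j)) (D r) (D c)
  have i2 := integral_dotProduct_mul_dotProduct (P := P) (u := u) (v := v)
    (fun i j => (hu i).integrable_mul (hv j)) (D r) (B c)
  have i3 := integral_dotProduct_mul_dotProduct (P := P) (u := v) (v := u)
    (fun i j => (hv i).integrable_mul (hu j)) (B r) (D c)
  have i4 := integral_dotProduct_mul_dotProduct (P := P) (u := v) (v := v)
    (fun i j => (hv i).integrable_mul (hv j)) (B r) (B c)
  simp only [huv, hvu, mul_zero, Finset.sum_const_zero] at i2 i3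
  rw [Matrix.add_apply, mul_of_mul_transpose_apply, mul_of_mul_transpose_apply, ← i1.2, ← i4.2]
  calc _ = ∫ ω, (((∑ i, D r i * u i ω) * ∑ i, D c i * u i ω)
          + (∑ i, D r i * u i ω) * ∑ j, B c j * v j ω)
        + (((∑ j, B r j * v j ω) * ∑ i, D c i * u i ω)
          + (∑ j, B r j * v j ω) * ∑ j, B c j * v j ω) ∂P := by
        refine integral_congr_ae (ae_of_all _ fun ω => ?_)
        simp only [Pi.add_apply, Matrix.mulVec, dotProduct]
        ring
    _ = _ := by
        refine (integral_add (i1.1.add i2.1) (i3.1.add i4.1)).trans ?_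
        refine (congrArg₂ (· + ·) (integral_add i1.1 i2.1) (integral_add i3.1 i4.1)).trans ?_
        simp only [i2.2, i3.2, add_zero, zero_add]

end SecondMoment

section Centroid

variable {N G M : ℕ} {net : Network N G} {A : Matrix (Fin N) (Fin N) ℝ}
  {J : Fin N → Vec M → ℝ} {wo : Fin N → Vec M} {p μ : Fin N → ℝ}

lemma blockDiag_sub (B C : Fin N → Matrix (Fin M) (Fin M) ℝ) :
    blockDiag B - blockDiag C = blockDiag fun k => B k - C k := by
  ext x y
  by_cases h : x.1 = y.1 <;> simp [blockDiag, h]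

lemma blockDiag_smul_one (c : ℝ) :
    blockDiag (fun _ : Fin N => c • (1 : Matrix (Fin M) (Fin M) ℝ)) = c • 1 := by
  ext ⟨k, a⟩ ⟨l, b⟩
  by_cases h : k = l <;> by_cases h' : a = b <;> simp [blockDiag, h, h', Matrix.one_apply]

lemma stepMatrix_eq_diagonal : stepMatrix M μ = Matrix.diagonal fun x => μ x.1 := by
  rw [stepMatrix, ← Matrix.diagonal_one, Matrix.diagonal_kronecker_diagonal]
  simp

lemma stepMatrix_transpose : (stepMatrix M μ)ᵀ = stepMatrix M μ := by
  rw [stepMatrix_eq_diagonal, Matrix.diagonal_transpose]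

lemma norm_stepMatrix_le {t : ℝ} (ht : 0 ≤ t) (hμ : ∀ k, 0 ≤ μ k) (hμt : ∀ k, μ k ≤ t) :
    ‖stepMatrix M μ‖ ≤ t := by
  rw [stepMatrix_eq_diagonal, Matrix.l2_opNorm_diagonal]
  refine (pi_norm_le_iff_of_nonneg ht).2 fun x => ?_
  rw [Real.norm_of_nonneg (hμ _)]
  exact hμt _

lemma l2_opNorm_transpose {m n : Type*} [Fintype m] [Fintype n] [DecidableEq m] [DecidableEq n]
    (B : Matrix m n ℝ) : ‖Bᵀ‖ = ‖B‖ := by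
  rw [← Matrix.conjTranspose_eq_transpose_of_trivial, Matrix.l2_opNorm_conjTranspose]

lemma stepMatrix_mul_perronMatrix_mulVec (x : Fin G × Fin M → ℝ) (k : Fin N) (a : Fin M) :
    ((stepMatrix M μ * perronMatrix M net p) *ᵥ x) (k, a) = μ k * p k * x (net.group k, a) := by
  rw [stepMatrix_eq_diagonal]
  simp only [Matrix.mulVec, dotProduct, Matrix.diagonal_mul, perronMatrix,
    Matrix.kroneckerMap_apply, Matrix.of_apply, Matrix.one_apply, Fintype.sum_prod_type]
  simp [mul_assoc]

/-- The driving matrix of the Lyapunov equation is positive definite. -/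
lemma posDef_driving {Rs : Matrix (Fin N × Fin M) (Fin N × Fin M) ℝ} (hR : Rs.PosDef)
    (hp : ∀ k, 0 < p k) (hμ : ∀ k, 0 < μ k) :
    ((perronMatrix M net p)ᵀ * stepMatrix M μ * Rs * stepMatrix M μ
      * perronMatrix M net p).PosDef := by
  have hinj : Function.Injective (stepMatrix M μ * perronMatrix M net p).mulVec := by
    intro x y hxy
    funext ⟨m, a⟩
    obtain ⟨⟨k, rfl⟩⟩ := (net.group_connected m).nonempty
    have h := congrFun hxy (k, a)
    rw [stepMatrix_mul_perronMatrix_mulVec, stepMatrix_mul_perronMatrix_mulVec] at h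
    exact mul_left_cancel₀ (mul_pos (hμ k) (hp k)).ne' h
  have h := hR.conjTranspose_mul_mul_same hinj
  rwa [Matrix.conjTranspose_eq_transpose_of_trivial, Matrix.transpose_mul, stepMatrix_transpose,
    ← Matrix.mul_assoc] at h

/-- The coefficient matrix of the centroid recursion is a symmetric contraction with factor
`1 - c t` for small step-sizes of comparable magnitude `t`. -/
lemma exists_lowMatrix_contraction (hJ : CostAssumption net J wo) (hp : ∀ k, 0 < p k)
    {τ : ℝ} (hτ : 0 < τ) :
    ∃ c > 0, ∀ᶠ t in 𝓝[>] (0 : ℝ), c * t < 1 ∧ ∀ μ : Fin N → ℝ, muMax μ = t →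
      (∀ k, τ * t ≤ μ k) → (∀ k, μ k ≤ t) →
      (lowMatrix net J wo p μ)ᵀ = lowMatrix net J wo p μ ∧
        ‖lowMatrix net J wo p μ‖ ≤ 1 - c * t := by
  obtain ⟨lamL, lamU, hlam0, hL, hU, hgroup⟩ := hJ.hess_bounds
  obtain ⟨c, hc, hcle⟩ := exists_pos_le
    (f := fun m : Fin G => ∑ k with net.group k = m, p k * τ * lamL k) (fun m => by
      obtain ⟨k, hk, hk0⟩ := hgroup m
      exact Finset.sum_pos'
        (fun j _ => mul_nonneg (mul_pos (hp j) hτ).le (hlam0 j).1)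
        ⟨k, by simp [hk], mul_pos (mul_pos (hp k) hτ) hk0⟩)
  refine ⟨c, hc, ?_⟩
  have e1 : ∀ᶠ t in 𝓝[>] (0 : ℝ), c * t < 1 :=
    eventually_lt_nhdsGT_zero (by fun_prop) (by simp)
  have e2 : ∀ᶠ t in 𝓝[>] (0 : ℝ), ∀ m : Fin G,
      t * ∑ k with net.group k = m, p k * lamU k < 1 :=
    eventually_all.2 fun m => eventually_lt_nhdsGT_zero (by fun_prop) (by simp)
  filter_upwards [e1, e2, self_mem_nhdsWithin] with t e1 e2 (ht : 0 < t)
  refine ⟨e1, fun μ hmax hμ hμt => ?_⟩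
  have hμ0 : ∀ k, 0 ≤ μ k := fun k => (mul_pos hτ ht).le.trans (hμ k)
  have hpμ : ∀ k, 0 ≤ p k * μ k := fun k => mul_nonneg (hp k).le (hμ0 k)
  have hblock : ∀ m, muMax μ • groupHess net J wo p μ m
      = ∑ k with net.group k = m, (p k * μ k) • hess (J k) (wo k) := by
    intro m
    rw [groupHess, Finset.smul_sum, hmax]
    refine Finset.sum_congr rfl fun k _ => ?_
    rw [smul_smul]
    congr 1
    field_simp
  have hpsd : (lowMatrix net J wo p μ).PosSemidef := by
    refine posSemidef_blockDiag fun m => ?_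
    rw [hblock]
    have hsum : ∑ k with net.group k = m, p k * μ k * lamU k ≤ 1 := by
      refine le_trans ?_ (e2 m).le
      rw [Finset.mul_sum]
      refine Finset.sum_le_sum fun k _ => ?_
      have := mul_le_mul_of_nonneg_left (hμt k)
        (mul_nonneg (hp k).le ((hlam0 k).1.trans (hlam0 k).2))
      linarith
    have h := (Matrix.posSemidef_sum (Finset.univ.filter fun k => net.group k = m)
      fun k _ => (hU k (wo k)).smul (hpμ k)).add
        ((Matrix.PosSemidef.one (n := Fin M) (R := ℝ)).smul (sub_nonneg.2 hsum))
    convert h using 1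
    simp only [smul_sub, smul_smul, Finset.sum_sub_distrib, ← Finset.sum_smul, sub_smul, one_smul]
    abel
  have hupper : ((1 - c * t) • (1 : Matrix (Fin G × Fin M) (Fin G × Fin M) ℝ)
      - lowMatrix net J wo p μ).PosSemidef := by
    rw [lowMatrix, ← blockDiag_smul_one, blockDiag_sub]
    refine posSemidef_blockDiag fun m => ?_
    rw [hblock]
    have hsum : c * t ≤ ∑ k with net.group k = m, p k * μ k * lamL k := by
      refine (mul_le_mul_of_nonneg_right (hcle m) ht.le).trans ?_
      rw [Finset.sum_mul]
      refine Finset.sum_le_sum fun k _ => ?_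
      have := mul_le_mul_of_nonneg_left (hμ k) (mul_nonneg (hp k).le (hlam0 k).1)
      linarith
    have h := (Matrix.posSemidef_sum (Finset.univ.filter fun k => net.group k = m)
      fun k _ => (hL k (wo k)).smul (hpμ k)).add
        ((Matrix.PosSemidef.one (n := Fin M) (R := ℝ)).smul (sub_nonneg.2 hsum))
    convert h using 1
    simp only [smul_sub, smul_smul, Finset.sum_sub_distrib, ← Finset.sum_smul, sub_smul, one_smul]
    abel
  refine ⟨?_, l2_opNorm_le_of_posSemidef (by linarith) hpsd hupper⟩
  simpa [Matrix.IsHermitian] using hpsd.1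

end Centroid

section LowError

variable {N G M : ℕ} {Ω : Type*} {mΩ : MeasurableSpace Ω} {P : Measure Ω}
  {ℱ : Filtration ℕ mΩ} {net : Network N G} {A : Matrix (Fin N) (Fin N) ℝ}
  {J : Fin N → Vec M → ℝ} {wo : Fin N → Vec M}
  {gradHat : Fin N → ℕ → Ω → Vec M → Vec M} {γ : ℝ}
  {Rs : Matrix (Fin N × Fin M) (Fin N × Fin M) ℝ} {p μ : Fin N → ℝ}
  {W₀ : Ω → NetVec N M} {X₀ : Ω → EuclideanSpace ℝ (Fin G × Fin M)}

lemma lowError_succ_apply (n : ℕ) (ω : Ω) (i : Fin G × Fin M) :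
    lowError net A J wo gradHat p μ W₀ X₀ (n + 1) ω i
      = ((lowMatrix net J wo p μ *ᵥ fun j => lowError net A J wo gradHat p μ W₀ X₀ n ω j)
        + ((perronMatrix M net p)ᵀ * stepMatrix M μ) *ᵥ
          fun y => noise J gradHat (n + 1) (iterates net A gradHat μ W₀ n) ω y.1 y.2) i :=
  rfl

lemma lowError_regular [IsProbabilityMeasure P] (hs : NoiseAssumption P ℱ J wo gradHat γ Rs)
    (hreg : ∀ n, StronglyMeasurable[ℱ n] (iterates net A gradHat μ W₀ n) ∧
      MemLp (iterates net A gradHat μ W₀ n) 4 P)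
    (hX₀ : StronglyMeasurable[ℱ 0] X₀) (hX₀2 : MemLp X₀ 2 P) (n : ℕ) :
    StronglyMeasurable[ℱ n] (lowError net A J wo gradHat p μ W₀ X₀ n) ∧
      MemLp (lowError net A J wo gradHat p μ W₀ X₀ n) 2 P := by
  induction n with
  | zero => exact ⟨hX₀, hX₀2⟩
  | succ n ih =>
    obtain ⟨hm, h2⟩ := ih
    have hsm := hs.adapted n _ (hreg n).1 (hreg n).2
    have hs4 := hs.memLp_noise (hreg n).1 (hreg n).2
    constructor
    · refine stronglyMeasurable_piLp fun i => ?_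
      simp only [lowError_succ_apply, Pi.add_apply, Matrix.mulVec, dotProduct]
      refine StronglyMeasurable.add ?_ ?_
      · exact Finset.stronglyMeasurable_fun_sum _ fun j _ =>
          ((stronglyMeasurable_piLp_apply hm j).mono (ℱ.mono n.le_succ)).const_mul _
      · exact Finset.stronglyMeasurable_fun_sum _ fun y _ =>
          (stronglyMeasurable_piLp_apply (stronglyMeasurable_piLp_apply hsm y.1) y.2).const_mul _
    · refine memLp_piLp fun i => ?_
      simp only [lowError_succ_apply, Pi.add_apply, Matrix.mulVec, dotProduct]
      refine MemLp.add ?_ ?_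
      · exact memLp_finsetSum _ fun j _ => (memLp_piLp_apply h2 j).const_mul _
      · exact memLp_finsetSum _ fun y _ => ((memLp_piLp_apply
          (memLp_piLp_apply hs4 y.1) y.2).mono_exponent (by norm_num)).const_mul _

/-- The recursion of the second moment of the centroid error. -/
lemma secondMoment_lowError_succ [IsProbabilityMeasure P]
    (hs : NoiseAssumption P ℱ J wo gradHat γ Rs)
    (hreg : ∀ n, StronglyMeasurable[ℱ n] (iterates net A gradHat μ W₀ n) ∧
      MemLp (iterates net A gradHat μ W₀ n) 4 P)
    (hX₀ : StronglyMeasurable[ℱ 0] X₀) (hX₀2 : MemLp X₀ 2 P) (n : ℕ) :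
    secondMoment P (lowError net A J wo gradHat p μ W₀ X₀ (n + 1))
      = lowMatrix net J wo p μ * secondMoment P (lowError net A J wo gradHat p μ W₀ X₀ n)
          * (lowMatrix net J wo p μ)ᵀ
        + ((perronMatrix M net p)ᵀ * stepMatrix M μ)
          * noiseCov P J gradHat n (iterates net A gradHat μ W₀ n)
          * ((perronMatrix M net p)ᵀ * stepMatrix M μ)ᵀ := by
  obtain ⟨hxm, hx2⟩ := lowError_regular (p := p) hs hreg hX₀ hX₀2 n
  have hs4 := hs.memLp_noise (hreg n).1 (hreg n).2
  have hs2 : ∀ y : Fin N × Fin M, MemLp (fun ω =>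
      noise J gradHat (n + 1) (iterates net A gradHat μ W₀ n) ω y.1 y.2) 2 P := fun y =>
    (memLp_piLp_apply (memLp_piLp_apply hs4 y.1) y.2).mono_exponent (by norm_num)
  have hcross : ∀ (j : Fin G × Fin M) (y : Fin N × Fin M),
      ∫ ω, lowError net A J wo gradHat p μ W₀ X₀ n ω j
        * noise J gradHat (n + 1) (iterates net A gradHat μ W₀ n) ω y.1 y.2 ∂P = 0 := by
    intro j y
    have h0 := condExp_clm_eq_zero (hs4.integrable (by norm_num))
      (hs.martingale_diff n _ (hreg n).1 (hreg n).2)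
      ((PiLp.proj (𝕜 := ℝ) 2 (fun _ : Fin M => ℝ) y.2).comp
        (PiLp.proj (𝕜 := ℝ) 2 (fun _ : Fin N => Vec M) y.1))
    exact integral_bilin_eq_zero (ℱ.le n) (ContinuousLinearMap.mul ℝ ℝ)
      (stronglyMeasurable_piLp_apply hxm j)
      ((memLp_piLp_apply hx2 j).integrable_mul (hs2 y))
      ((hs2 y).integrable (by norm_num)) h0
  ext i k
  exact integral_linear_comb_mul (fun j => memLp_piLp_apply hx2 j) hs2 hcross _ _ i k

end LowError

section LowErrorLimit

variable {N G M : ℕ} {Ω : Type*} {mΩ : MeasurableSpace Ω} {P : Measure Ω}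
  {ℱ : Filtration ℕ mΩ} {net : Network N G} {A : Matrix (Fin N) (Fin N) ℝ}
  {J : Fin N → Vec M → ℝ} {wo : Fin N → Vec M}
  {gradHat : Fin N → ℕ → Ω → Vec M → Vec M} {γ : ℝ}
  {Rs : Matrix (Fin N × Fin M) (Fin N × Fin M) ℝ} {p μ : Fin N → ℝ}
  {W₀ : Ω → NetVec N M} {X₀ : Ω → EuclideanSpace ℝ (Fin G × Fin M)}

/-- If the noise covariances along the iterates are eventually `b`-close to `Rs`, the second moment
of the centroid error is eventually close to the solution of the Lyapunov equation. -/
lemma eventually_norm_secondMoment_sub_le [IsProbabilityMeasure P]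
    (hs : NoiseAssumption P ℱ J wo gradHat γ Rs)
    (hreg : ∀ n, StronglyMeasurable[ℱ n] (iterates net A gradHat μ W₀ n) ∧
      MemLp (iterates net A gradHat μ W₀ n) 4 P)
    (hX₀ : StronglyMeasurable[ℱ 0] X₀) (hX₀2 : MemLp X₀ 2 P) {c t b : ℝ} (hc : 0 < c)
    (ht : 0 < t) (hct : c * t < 1) (hb : 0 < b) (hμ : ∀ k, 0 ≤ μ k) (hμt : ∀ k, μ k ≤ t)
    (hD : (lowMatrix net J wo p μ)ᵀ = lowMatrix net J wo p μ)
    (hDn : ‖lowMatrix net J wo p μ‖ ≤ 1 - c * t)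
    {Θ : Matrix (Fin G × Fin M) (Fin G × Fin M) ℝ} (hΘ : IsLyapunov net J wo p μ Rs Θ)
    (hcov : ∀ᶠ n in atTop,
      ‖noiseCov P J gradHat n (iterates net A gradHat μ W₀ n) - Rs‖ ≤ b) :
    ∀ᶠ n in atTop, ‖secondMoment P (lowError net A J wo gradHat p μ W₀ X₀ n) - Θ‖
      ≤ 2 * (‖perronMatrix M net p‖ ^ 2 + 1) / c * t * b := by
  set D := lowMatrix net J wo p μ with hDdef
  set B := (perronMatrix M net p)ᵀ * stepMatrix M μ with hB
  have hBn : ‖B‖ ≤ ‖perronMatrix M net p‖ * t := by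
    refine (Matrix.l2_opNorm_mul _ _).trans ?_
    rw [l2_opNorm_transpose]
    exact mul_le_mul_of_nonneg_left (norm_stepMatrix_le ht.le hμ hμt) (norm_nonneg _)
  have hBt : Bᵀ = stepMatrix M μ * perronMatrix M net p := by
    rw [hB, Matrix.transpose_mul, stepMatrix_transpose, Matrix.transpose_transpose]
  have hΘ' : Θ = D * Θ * Dᵀ + B * Rs * Bᵀ := by
    rw [hD, hBt, ← Matrix.mul_assoc]
    exact hΘ
  have hrec : ∀ᶠ n in atTop,
      ‖secondMoment P (lowError net A J wo gradHat p μ W₀ X₀ (n + 1)) - Θ‖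
        ≤ (1 - c * t) * ‖secondMoment P (lowError net A J wo gradHat p μ W₀ X₀ n) - Θ‖
          + (‖perronMatrix M net p‖ ^ 2 + 1) * t ^ 2 * b := by
    filter_upwards [hcov] with n hn
    set S := secondMoment P (lowError net A J wo gradHat p μ W₀ X₀ n)
    set R := noiseCov P J gradHat n (iterates net A gradHat μ W₀ n)
    have heq : secondMoment P (lowError net A J wo gradHat p μ W₀ X₀ (n + 1)) - Θ
        = D * (S - Θ) * Dᵀ + B * (R - Rs) * Bᵀ := by
      rw [secondMoment_lowError_succ hs hreg hX₀ hX₀2 n]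
      nth_rewrite 1 [hΘ']
      simp only [Matrix.mul_sub, Matrix.sub_mul]
      abel
    have h1 : ‖D * (S - Θ) * Dᵀ‖ ≤ (1 - c * t) * ‖S - Θ‖ := by
      calc ‖D * (S - Θ) * Dᵀ‖ ≤ ‖D‖ * ‖S - Θ‖ * ‖Dᵀ‖ :=
            (Matrix.l2_opNorm_mul _ _).trans
              (mul_le_mul_of_nonneg_right (Matrix.l2_opNorm_mul _ _) (norm_nonneg _))
        _ ≤ (1 - c * t) * ‖S - Θ‖ * 1 := by
            rw [hD]
            have : 0 < c * t := mul_pos hc ht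
            gcongr
            · linarith
        _ = _ := mul_one _
    have h2 : ‖B * (R - Rs) * Bᵀ‖ ≤ (‖perronMatrix M net p‖ ^ 2 + 1) * t ^ 2 * b := by
      calc ‖B * (R - Rs) * Bᵀ‖ ≤ ‖B‖ * ‖R - Rs‖ * ‖Bᵀ‖ :=
            (Matrix.l2_opNorm_mul _ _).trans
              (mul_le_mul_of_nonneg_right (Matrix.l2_opNorm_mul _ _) (norm_nonneg _))
        _ ≤ (‖perronMatrix M net p‖ * t) * b * (‖perronMatrix M net p‖ * t) := by
            rw [l2_opNorm_transpose]
            gcongr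
        _ = ‖perronMatrix M net p‖ ^ 2 * t ^ 2 * b := by ring
        _ ≤ _ := by gcongr; linarith
    rw [heq]
    exact (norm_add_le _ _).trans (add_le_add h1 h2)
  have h := eventually_le_of_recursion
    (a := fun n => ‖secondMoment P (lowError net A J wo gradHat p μ W₀ X₀ n) - Θ‖)
    (by linarith) (by linarith [mul_pos hc ht]) (by positivity) hrec
  filter_upwards [h] with n hn
  refine hn.trans (le_of_eq ?_)
  rw [sub_sub_cancel]
  field_simp

end LowErrorLimit

end DiffusionNet

theorem mainTheorem8 {N G M : ℕ} {Ω : Type*} {mΩ : MeasurableSpace Ω}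
    (P : Measure Ω) [IsProbabilityMeasure P] (ℱ : Filtration ℕ mΩ)
    (net : DiffusionNet.Network N G)
    (A : Matrix (Fin N) (Fin N) ℝ) (hA : DiffusionNet.IsCombination net A)
    (p : Fin N → ℝ) (hp : DiffusionNet.IsPerron net A p)
    (J : Fin N → DiffusionNet.Vec M → ℝ) (wo : Fin N → DiffusionNet.Vec M)
    (hJ : DiffusionNet.CostAssumption net J wo)
    (gradHat : Fin N → ℕ → Ω → DiffusionNet.Vec M → DiffusionNet.Vec M)
    (γ : ℝ) (Rs : Matrix (Fin N × Fin M) (Fin N × Fin M) ℝ)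
    (hs : DiffusionNet.NoiseAssumption P ℱ J wo gradHat γ Rs)
    (τ : ℝ) (hτ : 0 < τ) :
    ∃ μ₀ : ℝ, 0 < μ₀ ∧ ∃ C : ℝ, 0 ≤ C ∧
      ∀ μ : Fin N → ℝ, (∀ k, 0 < μ k) → (∀ k, τ * DiffusionNet.muMax μ ≤ μ k) →
        DiffusionNet.muMax μ ≤ μ₀ →
        ∃ Θ : Matrix (Fin G × Fin M) (Fin G × Fin M) ℝ,
          Θ.IsSymm ∧ Θ.PosDef ∧
          DiffusionNet.IsLyapunov net J wo p μ Rs Θ ∧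
          (∀ Θ', DiffusionNet.IsLyapunov net J wo p μ Rs Θ' → Θ' = Θ) ∧
          ∀ (W₀ : Ω → DiffusionNet.NetVec N M) (X₀ : Ω → EuclideanSpace ℝ (Fin G × Fin M)),
            StronglyMeasurable[ℱ 0] W₀ → MemLp W₀ 4 P →
            StronglyMeasurable[ℱ 0] X₀ → MemLp X₀ 2 P →
            (∀ i, MemLp (DiffusionNet.lowError net A J wo gradHat p μ W₀ X₀ i) 2 P) ∧
            limsup (fun i => ENNReal.ofReal
                ‖DiffusionNet.secondMoment P
                    (DiffusionNet.lowError net A J wo gradHat p μ W₀ X₀ i) - Θ‖) atTop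
              ≤ ENNReal.ofReal (C * DiffusionNet.muMax μ ^ (1 + γ / 2)) := by
  have hpp := hp.pos hA
  obtain ⟨K, hK, hstab⟩ := DiffusionNet.exists_fourth_moment_bound hA hp hJ hs hτ
  obtain ⟨c, hc, hcontr⟩ := DiffusionNet.exists_lowMatrix_contraction hJ hpp hτ
  obtain ⟨C, hC, hcov⟩ := hs.exists_norm_noiseCov_sub_le hK
  obtain ⟨μ₀, hμ₀, hsub⟩ := mem_nhdsGT_iff_exists_Ioc_subset.1 (hstab.and hcontr)
  refine ⟨μ₀, hμ₀, 2 * (‖DiffusionNet.perronMatrix M net p‖ ^ 2 + 1) / c * (C + 1),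
    by positivity, fun μ hμ hμτ hμmax => ?_⟩
  rcases isEmpty_or_nonempty (Fin N) with hN | hN
  · have hG : IsEmpty (Fin G) := ⟨fun m => by
      obtain ⟨⟨k, -⟩⟩ := (net.group_connected m).nonempty
      exact hN.elim k⟩
    refine ⟨0, Subsingleton.elim _ _, .of_dotProduct_mulVec_pos (Subsingleton.elim _ _)
      fun x hx => absurd (Subsingleton.elim _ _) hx, Subsingleton.elim _ _,
      fun _ _ => Subsingleton.elim _ _, fun W₀ X₀ _ _ _ _ => ⟨fun i => ?_, ?_⟩⟩
    · rw [show DiffusionNet.lowError net A J wo gradHat p μ W₀ X₀ i = fun _ => 0 from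
        funext fun _ => Subsingleton.elim _ _]
      exact memLp_const 0
    · have h0 : ∀ i, DiffusionNet.secondMoment P
          (DiffusionNet.lowError net A J wo gradHat p μ W₀ X₀ i) - 0 = 0 := fun _ =>
        Subsingleton.elim _ _
      simp only [h0, norm_zero, ENNReal.ofReal_zero, limsup_const, zero_le]
  have hle : ∀ k, μ k ≤ DiffusionNet.muMax μ := le_ciSup (Set.finite_range μ).bddAbove
  have ht : 0 < DiffusionNet.muMax μ := (hμ hN.some).trans_le (hle hN.some)
  obtain ⟨hstab, hct, hcontr⟩ := hsub ⟨ht, hμmax⟩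
  obtain ⟨hDt, hDn⟩ := hcontr μ rfl hμτ hle
  obtain ⟨Θ, hsymm, hpos, hsol, huniq⟩ := DiffusionNet.exists_lyapunov hDt
    (hDn.trans_lt (by linarith [mul_pos hc ht]))
    (DiffusionNet.posDef_driving (net := net) hs.cov_posDef hpp hμ)
  refine ⟨Θ, hsymm, hpos, hsol, huniq, fun W₀ X₀ hW₀ hW₀4 hX₀ hX₀2 => ?_⟩
  obtain ⟨hreg, hmom⟩ := hstab μ hμτ hle W₀ hW₀ hW₀4
  refine ⟨fun i => (DiffusionNet.lowError_regular hs hreg hX₀ hX₀2 i).2, ?_⟩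
  have hθ : 0 < DiffusionNet.muMax μ ^ (γ / 2) := by positivity
  have hclose := (hcov _ ht _ hreg hmom).mono fun n hn => hn.trans
    (mul_le_mul_of_nonneg_right (le_add_of_nonneg_right zero_le_one) hθ.le)
  have hfin := DiffusionNet.eventually_norm_secondMoment_sub_le hs hreg hX₀ hX₀2 hc ht hct
    (b := (C + 1) * DiffusionNet.muMax μ ^ (γ / 2)) (by positivity) (fun k => (hμ k).le) hle hDt
    hDn hsol hclose
  refine limsup_le_of_le (by isBoundedDefault) (hfin.mono fun n hn => ENNReal.ofReal_le_ofReal ?_)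
  refine hn.trans (le_of_eq ?_)
  rw [Real.rpow_add ht, Real.rpow_one]
  ring
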